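/- There is an absolute constant $C>0$ such that the following holds. Let $q\ge 3$, $k\ge 0$ and $n\ge 2$ be integers, let $\delta,\varepsilon>0$ be real numbers, and let $E:\{\pm1\}^k\to\{\pm1\}^n$ be an arbitrary (possibly non-linear) map that is a $(q,\delta,\varepsilon)$-locally decodable code. Then $$k\;\le\; n^{1-\frac{2}{q}}\cdot\frac{2^{Cq}\,\log^4 n}{\varepsilon^6\,\delta^2}.$$ Here $\log$ is the natural logarithm, and $E$ is called $(q,\delta,\varepsilon)$-locally decodable if there is a randomized decoding algorithm $\mathsf{Dec}$ which takes an index $i\in[k]$ as input, has oracle access to a string $y\in\{\pm1\}^n$, makes at most $q$ (possibly adaptive) queries to coordinates of $y$, and satisfies $\Pr[\mathsf{Dec}^{y}(i)=b_i]\ge \frac12+\varepsilon$ for every $i\in[k]$, every $b\in\{\pm1\}^k$ and every $y\in\{\pm1\}^n$ that differs from $E(b)$ in at most $\delta n$ coordinates. -/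

import Mathlib

/-- A deterministic (adaptive) algorithm with oracle access to a string `y ∈ {±1}^n`:
either it halts with an output in `{±1}`, or it queries a coordinate `v` of `y` and continues
in a way that depends on the answer `y v`. Signs `{±1}` are the units `ℤˣ` of `ℤ`. -/
inductive OracleAlg (n : ℕ) : Type
  | output (a : ℤˣ) : OracleAlg n
  | query (v : Fin n) (next : ℤˣ → OracleAlg n) : OracleAlg n

namespace OracleAlg

/-- The output of the algorithm when the oracle is `y`. -/
def run {n : ℕ} (y : Fin n → ℤˣ) : OracleAlg n → ℤˣ
  | output a => a
  | query v next => run y (next (y v))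

/-- The number of queries the algorithm makes when the oracle is `y`. -/
def numQueries {n : ℕ} (y : Fin n → ℤˣ) : OracleAlg n → ℕ
  | output _ => 0
  | query v next => numQueries y (next (y v)) + 1

end OracleAlg

/-- `E : {±1}^k → {±1}^n` is a `(q, δ, ε)`-locally decodable code. A randomized decoder is, for
each index `i`, a probability distribution over deterministic oracle algorithms (the internal
coin tosses select the algorithm that is then run). It always makes at most `q` queries,
whatever its coins and the string `y` are, and on every `y` within Hamming distance `δ n` of
`E b` it outputs `b i` with probability at least `1/2 + ε`. -/
def IsLocallyDecodable {k n : ℕ} (q : ℕ) (δ ε : ℝ)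
    (E : (Fin k → ℤˣ) → (Fin n → ℤˣ)) : Prop :=
  ∃ Dec : Fin k → PMF (OracleAlg n),
    (∀ (i : Fin k) (A : OracleAlg n), A ∈ (Dec i).support →
      ∀ y : Fin n → ℤˣ, A.numQueries y ≤ q) ∧
    (∀ (i : Fin k) (b : Fin k → ℤˣ) (y : Fin n → ℤˣ),
      (hammingDist y (E b) : ℝ) ≤ δ * (n : ℝ) →
        1 / 2 + ε ≤ ((Dec i).map (OracleAlg.run y) (b i)).toReal)

/-! The decoder becomes a refutation problem. The bias of an adaptive `q`-query decoder is a
polynomial of degree at most `q` in the queried signs, with coefficients of absolute sum at most `2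
^ q`. Overwriting the at most `δ n` coordinates that it queries too often is a corruption which it
must tolerate. So each message bit correlates with a signed system of `q`-tuples in which every
coordinate has weight at most `q / (δ n)` in each slot (`exists_smooth_system`). Averaged over
random messages, the signed sum of these systems is large. It remains to bound such sums from above
when the codeword may depend on the signs arbitrarily.

The tool is a Kikuchi matrix. A sum of monomials, each split into two halves of equal degree, is a
quadratic form on sequences arranged in blocks of length `m`, evaluated at a product sign vector. If
the halves are spread at density `m / |V|`, pruning vertices of large degree bounds all row and
column sums. A Khintchine inequality for matrices (`sum_quadForm_le`), proved by trace moments, then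
gives `sum_signed_monomials_le`.

Spread halves of equal size are produced for both parities of `q` at once. With `κ ^ 2 = m / |V|`,
give each tuple the slot set `P` whose degree is largest relative to `κ ^ min (2 * #P) q`, and keep
one `P` that carries a `2 ^ (-q)` share of the signal. Cauchy–Schwarz over tuples with a common
restriction to `P` leads to pairs of tuples agreeing on `P`. There the slots in `P` cancel, and the
others are distributed so that each half takes about half of its slots from each tuple; maximality
of `P` gives the spread. Diagonal terms are small by smoothness, and a random bipartition of the
colours decouples the rest. The outcome, `smooth_system_bound`, is `k ≲ m log n` up to powers of `ε`
and factors exponential in `q`. It applies as soon as `κ ^ q` exceeds a multiple of `1 / (δ n)`,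
that is, for `m` of order `n ^ (1 - 2 / q)`. -/

open Finset

/-! ### Signs and sums over sign vectors -/

/-- A sign as a real number. -/
def sgn (u : ℤˣ) : ℝ := ((u : ℤ) : ℝ)

lemma sgn_one : sgn 1 = 1 := by simp [sgn]

lemma sgn_neg (u : ℤˣ) : sgn (-u) = - sgn u := by simp [sgn]

lemma sgn_mul_self (u : ℤˣ) : sgn u * sgn u = 1 := by
  rcases Int.units_eq_one_or u with rfl | rfl <;> simp [sgn]

lemma abs_sgn (u : ℤˣ) : |sgn u| = 1 := by
  rcases Int.units_eq_one_or u with rfl | rfl <;> simp [sgn]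

lemma sum_units_int (f : ℤˣ → ℝ) : ∑ s : ℤˣ, f s = f 1 + f (-1) := by
  have : (univ : Finset ℤˣ) = {1, -1} := by decide
  rw [this, sum_pair (by decide)]

lemma sum_signs_prod {ι : Type*} [Fintype ι] [DecidableEq ι] (g : ι → ℤˣ → ℝ) :
    ∑ b : ι → ℤˣ, ∏ i, g i (b i) = ∏ i, (g i 1 + g i (-1)) := by
  simp_rw [← sum_units_int, prod_univ_sum, Fintype.piFinset_univ]

lemma card_signs (ι : Type*) [Fintype ι] [DecidableEq ι] :
    (Fintype.card (ι → ℤˣ) : ℝ) = 2 ^ Fintype.card ι := by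
  simp [Fintype.card_units_int]

/-- The character `b ↦ ∏ i, b_i ^ c_i` on sign vectors. -/
def signMonomial {ι : Type*} [Fintype ι] (c : ι → ℕ) (b : ι → ℤˣ) : ℝ := ∏ i, sgn (b i) ^ c i

/-- The sum factors over coordinates and every factor is 0 or 2. This positivity drives the
comparison of matrix and scalar moments. -/
lemma sum_signMonomial_nonneg {ι : Type*} [Fintype ι] [DecidableEq ι] (c : ι → ℕ) :
    0 ≤ ∑ b : ι → ℤˣ, signMonomial c b := by
  unfold signMonomial
  rw [sum_signs_prod fun i s => sgn s ^ c i]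
  refine prod_nonneg fun i _ => ?_
  rw [sgn_neg, sgn_one, one_pow]
  rcases neg_one_pow_eq_or ℝ (c i) with h | h <;> rw [h] <;> norm_num

lemma sgn_mul_signMonomial {ι : Type*} [Fintype ι] [DecidableEq ι] (c : ι → ℕ) (i : ι)
    (b : ι → ℤˣ) : sgn (b i) * signMonomial c b = signMonomial (c + Pi.single i 1) b := by
  unfold signMonomial
  simp_rw [Pi.add_apply, pow_add, prod_mul_distrib]
  rw [mul_comm]
  congr 1
  rw [prod_eq_single i]
  · simp
  · intro j _ hj; simp [hj]
  · simp

/-! ### A Khintchine inequality for matrices by trace moments -/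

/-- Expand both powers into words in `ι`. Summing over signs gives each word the same nonnegative
coefficient on both sides, and a product of `r` of the matrices has absolute row sums at most `Δ ^
r`. The monomial `c` records the letters already peeled off, which lets the induction close. -/
lemma sum_abs_pow_apply_le {ι Ω : Type*} [Fintype ι] [DecidableEq ι] [Fintype Ω] [DecidableEq Ω]
    (B : ι → Matrix Ω Ω ℝ) {Δ : ℝ} (hB : ∀ i S, ∑ T, |B i S T| ≤ Δ) (r : ℕ)
    (c : ι → ℕ) (S : Ω) :
    ∑ T, |∑ b : ι → ℤˣ, ((∑ i, sgn (b i) • B i) ^ r) S T * signMonomial c b| ≤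
      Δ ^ r * ∑ b : ι → ℤˣ, (∑ i, sgn (b i)) ^ r * signMonomial c b := by
  induction r generalizing c S with
  | zero =>
    simp only [pow_zero, one_mul]
    rw [Finset.sum_eq_single S]
    · simp [abs_of_nonneg (sum_signMonomial_nonneg c)]
    · intro T _ hT
      simp [Matrix.one_apply_ne hT.symm]
    · simp
  | succ r ih =>
    have key : ∀ T, ∑ b : ι → ℤˣ, ((∑ i, sgn (b i) • B i) ^ (r + 1)) S T * signMonomial c b =
        ∑ i, ∑ V, B i S V *
          ∑ b : ι → ℤˣ, ((∑ i, sgn (b i) • B i) ^ r) V T * signMonomial (c + Pi.single i 1) b := by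
      intro T
      have : ∀ b : ι → ℤˣ, ((∑ i, sgn (b i) • B i) ^ (r + 1)) S T * signMonomial c b =
          ∑ i, ∑ V, B i S V *
            (((∑ i, sgn (b i) • B i) ^ r) V T * signMonomial (c + Pi.single i 1) b) := by
        intro b
        rw [pow_succ', Matrix.mul_apply, sum_comm, sum_mul]
        refine sum_congr rfl fun V _ => ?_
        rw [Matrix.sum_apply, sum_mul, sum_mul]
        refine sum_congr rfl fun i _ => ?_
        rw [← sgn_mul_signMonomial, Matrix.smul_apply, smul_eq_mul]
        ring
      simp_rw [this, mul_sum]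
      rw [sum_comm]
      refine sum_congr rfl fun i _ => ?_
      rw [sum_comm]
    calc ∑ T, |∑ b : ι → ℤˣ, ((∑ i, sgn (b i) • B i) ^ (r + 1)) S T * signMonomial c b|
        ≤ ∑ T, ∑ i, ∑ V, |B i S V| * |∑ b : ι → ℤˣ,
            ((∑ i, sgn (b i) • B i) ^ r) V T * signMonomial (c + Pi.single i 1) b| := by
          refine sum_le_sum fun T _ => ?_
          rw [key]
          refine (abs_sum_le_sum_abs _ _).trans (sum_le_sum fun i _ => ?_)
          refine (abs_sum_le_sum_abs _ _).trans (sum_le_sum fun V _ => ?_)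
          rw [abs_mul]
      _ = ∑ i, ∑ V, |B i S V| * ∑ T, |∑ b : ι → ℤˣ,
            ((∑ i, sgn (b i) • B i) ^ r) V T * signMonomial (c + Pi.single i 1) b| := by
          rw [sum_comm]
          refine sum_congr rfl fun i _ => ?_
          rw [sum_comm]
          simp_rw [mul_sum]
      _ ≤ ∑ i, Δ * (Δ ^ r * ∑ b : ι → ℤˣ,
            (∑ i, sgn (b i)) ^ r * signMonomial (c + Pi.single i 1) b) := by
          refine sum_le_sum fun i _ => ?_
          have h0 : 0 ≤ Δ ^ r * ∑ b : ι → ℤˣ,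
              (∑ i, sgn (b i)) ^ r * signMonomial (c + Pi.single i 1) b :=
            (sum_nonneg fun _ _ => abs_nonneg _).trans (ih (c + Pi.single i 1) S)
          calc _ ≤ ∑ V, |B i S V| * (Δ ^ r * ∑ b : ι → ℤˣ,
              (∑ i, sgn (b i)) ^ r * signMonomial (c + Pi.single i 1) b) :=
                sum_le_sum fun V _ =>
                  mul_le_mul_of_nonneg_left (ih (c + Pi.single i 1) V) (abs_nonneg _)
            _ ≤ _ := by
                rw [← sum_mul]
                exact mul_le_mul_of_nonneg_right (hB i S) h0
      _ = _ := by
          rw [← mul_sum, ← mul_sum, ← mul_assoc, ← pow_succ', sum_comm]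
          congr 1
          refine sum_congr rfl fun b _ => ?_
          simp_rw [← sgn_mul_signMonomial]
          rw [pow_succ, mul_assoc, sum_mul, mul_sum]

lemma sum_trace_pow_le {ι Ω : Type*} [Fintype ι] [DecidableEq ι] [Fintype Ω] [DecidableEq Ω]
    (B : ι → Matrix Ω Ω ℝ) {Δ : ℝ} (hB : ∀ i S, ∑ T, |B i S T| ≤ Δ) (r : ℕ) :
    ∑ b : ι → ℤˣ, ((∑ i, sgn (b i) • B i) ^ r).trace ≤
      Fintype.card Ω * (Δ ^ r * ∑ b : ι → ℤˣ, (∑ i, sgn (b i)) ^ r) := by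
  have h1 : ∀ b : ι → ℤˣ, signMonomial 0 b = 1 := fun b => by simp [signMonomial]
  unfold Matrix.trace
  rw [sum_comm, ← nsmul_eq_mul]
  refine sum_le_card_nsmul _ _ _ fun S _ => ?_
  have h := sum_abs_pow_apply_le B hB r 0 S
  simp only [h1, mul_one] at h
  refine le_trans ?_ h
  refine le_trans (le_abs_self _) ?_
  exact single_le_sum (f := fun T => |∑ b : ι → ℤˣ, ((∑ i, sgn (b i) • B i) ^ r) S T|)
    (fun _ _ => abs_nonneg _) (mem_univ S)

/-- Exponential moments: one term of the cosh series bounds the power, and the sum of `cosh (l * ∑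
b_i)` over signs is `(2 cosh l) ^ k`. -/
lemma sum_signs_pow_le {ι : Type*} [Fintype ι] [DecidableEq ι] [Nonempty ι] {p : ℕ} (hp : 0 < p) :
    ∑ b : ι → ℤˣ, (∑ i, sgn (b i)) ^ (2 * p) ≤
      2 ^ Fintype.card ι * (2 * Real.exp 1 * p * Fintype.card ι) ^ p := by
  set k : ℝ := ((Fintype.card ι : ℕ) : ℝ) with hk
  have hk0 : 0 < k := by rw [hk]; exact_mod_cast Fintype.card_pos
  have hp0 : (0 : ℝ) < p := by exact_mod_cast hp
  -- This `l` minimises `exp (k l ^ 2 / 2) / l ^ (2 * p)`; the exponent becomes exactly `p`.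
  set l : ℝ := Real.sqrt (2 * p / k) with hl
  have hl2 : l ^ 2 = 2 * p / k := Real.sq_sqrt (by positivity)
  have hl0 : 0 < l := Real.sqrt_pos.2 (by positivity)
  have hterm : ∀ y : ℝ, y ^ (2 * p) ≤ (2 * p).factorial / l ^ (2 * p) * Real.cosh (l * y) := by
    intro y
    have h : (l * y) ^ (2 * p) / (2 * p).factorial ≤ Real.cosh (l * y) := by
      have hs := Real.hasSum_cosh (l * y)
      exact le_hasSum hs p fun j _ => by
        rw [pow_mul]; positivity
    rw [div_le_iff₀ (by positivity), mul_pow] at h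
    rw [div_mul_eq_mul_div, le_div_iff₀ (by positivity)]
    nlinarith
  have hcosh : ∑ b : ι → ℤˣ, Real.cosh (l * ∑ i, sgn (b i)) ≤
      2 ^ Fintype.card ι * Real.exp p := by
    have h1 : ∀ t : ℝ, ∑ b : ι → ℤˣ, Real.exp (t * ∑ i, sgn (b i)) =
        (2 * Real.cosh t) ^ Fintype.card ι := by
      intro t
      simp_rw [mul_sum, Real.exp_sum]
      rw [sum_signs_prod fun _ s => Real.exp (t * sgn s)]
      rw [prod_const, card_univ, Real.cosh_eq, sgn_neg, sgn_one]
      congr 1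
      rw [mul_one, mul_neg, mul_one]; ring
    have h2 : ∑ b : ι → ℤˣ, Real.cosh (l * ∑ i, sgn (b i)) =
        (2 * Real.cosh l) ^ Fintype.card ι := by
      simp_rw [Real.cosh_eq (l * _)]
      rw [← sum_div, sum_add_distrib, h1]
      simp_rw [← neg_mul]
      rw [h1, Real.cosh_neg]; ring
    rw [h2, mul_pow]
    refine mul_le_mul_of_nonneg_left ?_ (by positivity)
    calc Real.cosh l ^ Fintype.card ι ≤ Real.exp (l ^ 2 / 2) ^ Fintype.card ι :=
          pow_le_pow_left₀ (Real.cosh_pos l).le (Real.cosh_le_exp_half_sq l) _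
      _ = Real.exp p := by
          rw [← Real.exp_nat_mul, hl2, ← hk]
          congr 1; field_simp
  calc ∑ b : ι → ℤˣ, (∑ i, sgn (b i)) ^ (2 * p)
      ≤ ∑ b : ι → ℤˣ, (2 * p).factorial / l ^ (2 * p) * Real.cosh (l * ∑ i, sgn (b i)) :=
        sum_le_sum fun b _ => hterm _
    _ ≤ (2 * p).factorial / l ^ (2 * p) * (2 ^ Fintype.card ι * Real.exp p) := by
        rw [← mul_sum]
        exact mul_le_mul_of_nonneg_left hcosh (by positivity)
    _ ≤ (2 * p : ℝ) ^ (2 * p) / l ^ (2 * p) * (2 ^ Fintype.card ι * Real.exp p) := by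
        gcongr
        exact_mod_cast Nat.factorial_le_pow (2 * p)
    _ = _ := by
        rw [pow_mul l, hl2, pow_mul (2 * (p : ℝ)), ← div_pow]
        have : Real.exp p = Real.exp 1 ^ p := by rw [← Real.exp_nat_mul]; simp
        rw [this, mul_left_comm, ← mul_pow]
        congr 2
        field_simp

lemma dotProduct_sq_le {Ω : Type*} [Fintype Ω] (u v : Ω → ℝ) :
    (u ⬝ᵥ v) ^ 2 ≤ (u ⬝ᵥ u) * (v ⬝ᵥ v) := by
  simp only [dotProduct]
  simpa [sq] using sum_mul_sq_le_sq_mul_sq univ u v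

/-- By symmetry and Cauchy–Schwarz, `(z · B ^ j z) ^ 2 ≤ (z · z) (z · B ^ (2 j) z)`. Iterating this
doubling avoids the spectral theorem, at the price of exponents that are powers of two. -/
lemma quadForm_pow_two_pow_le {Ω : Type*} [Fintype Ω] [DecidableEq Ω] {B : Matrix Ω Ω ℝ}
    (hB : B.IsSymm) (z : Ω → ℝ) (t : ℕ) :
    (z ⬝ᵥ B.mulVec z) ^ (2 ^ t) * (z ⬝ᵥ z) ≤ (z ⬝ᵥ z) ^ (2 ^ t) * (z ⬝ᵥ (B ^ (2 ^ t)).mulVec z) := by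
  have hz : 0 ≤ z ⬝ᵥ z := sum_nonneg fun _ _ => mul_self_nonneg _
  have hstep : ∀ j, z ⬝ᵥ (B ^ (2 * j)).mulVec z = (B ^ j).mulVec z ⬝ᵥ (B ^ j).mulVec z := by
    intro j
    rw [two_mul, pow_add, ← Matrix.mulVec_mulVec, Matrix.dotProduct_mulVec,
      ← Matrix.mulVec_transpose, (hB.pow j).eq]
  rcases hz.eq_or_lt with h0 | h0
  · have hz0 : z = 0 := dotProduct_self_eq_zero.1 h0.symm
    simp [hz0]
  suffices h : |z ⬝ᵥ B.mulVec z| ^ (2 ^ t) * (z ⬝ᵥ z) ≤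
      (z ⬝ᵥ z) ^ (2 ^ t) * |z ⬝ᵥ (B ^ (2 ^ t)).mulVec z| by
    rcases Nat.eq_zero_or_pos t with rfl | ht
    · simp [mul_comm]
    · have he : Even (2 ^ t) := (Nat.even_pow.2 ⟨even_two, ht.ne'⟩)
      rw [he.pow_abs] at h
      rwa [abs_of_nonneg] at h
      obtain ⟨t, rfl⟩ := Nat.exists_eq_succ_of_ne_zero ht.ne'
      rw [pow_succ', hstep]
      exact sum_nonneg fun _ _ => mul_self_nonneg _
  induction t with
  | zero => simp [mul_comm]
  | succ t ih =>
    have h1 := dotProduct_sq_le z ((B ^ (2 ^ t)).mulVec z)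
    rw [← hstep, ← sq_abs, ← pow_succ'] at h1
    have h2 := pow_le_pow_left₀ (by positivity) ih 2
    have h3 : (z ⬝ᵥ z) * (|z ⬝ᵥ B.mulVec z| ^ (2 ^ (t + 1)) * (z ⬝ᵥ z)) ≤
        (z ⬝ᵥ z) * ((z ⬝ᵥ z) ^ (2 ^ (t + 1)) * |z ⬝ᵥ (B ^ (2 ^ (t + 1))).mulVec z|) := by
      calc _ = (|z ⬝ᵥ B.mulVec z| ^ (2 ^ t) * (z ⬝ᵥ z)) ^ 2 := by ring
        _ ≤ _ := h2
        _ = (z ⬝ᵥ z) ^ (2 ^ (t + 1)) * |z ⬝ᵥ (B ^ (2 ^ t)).mulVec z| ^ 2 := by ring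
        _ ≤ (z ⬝ᵥ z) ^ (2 ^ (t + 1)) *
            ((z ⬝ᵥ z) * |z ⬝ᵥ (B ^ (2 ^ (t + 1))).mulVec z|) := by
            gcongr
            exact h1.trans (mul_le_mul_of_nonneg_left (le_abs_self _) hz)
        _ = _ := by ring
    exact le_of_mul_le_mul_left h3 h0

/-- For symmetric `B` the trace of `B ^ 2` is the squared Hilbert–Schmidt norm. -/
lemma quadForm_sq_le_trace {Ω : Type*} [Fintype Ω] [DecidableEq Ω] {B : Matrix Ω Ω ℝ}
    (hB : B.IsSymm) (z : Ω → ℝ) :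
    (z ⬝ᵥ B.mulVec z) ^ 2 ≤ (z ⬝ᵥ z) ^ 2 * (B ^ 2).trace := by
  have h1 := dotProduct_sq_le z (B.mulVec z)
  have h2 : B.mulVec z ⬝ᵥ B.mulVec z ≤ (B ^ 2).trace * (z ⬝ᵥ z) := by
    rw [Matrix.trace, sum_mul, dotProduct]
    refine sum_le_sum fun S _ => ?_
    have h3 := dotProduct_sq_le (B S) z
    have h4 : (B ^ 2).diag S = B S ⬝ᵥ B S := by
      rw [Matrix.diag_apply, sq, Matrix.mul_apply, dotProduct]
      exact sum_congr rfl fun T _ => by rw [hB.apply]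
    rw [h4, ← sq]
    exact h3
  have hz : 0 ≤ z ⬝ᵥ z := sum_nonneg fun _ _ => mul_self_nonneg _
  nlinarith [mul_le_mul_of_nonneg_left h2 hz]

lemma quadForm_pow_le_trace {Ω : Type*} [Fintype Ω] [DecidableEq Ω] {B : Matrix Ω Ω ℝ}
    (hB : B.IsSymm) (z : Ω → ℝ) (hz : 0 < z ⬝ᵥ z) (t : ℕ) :
    (z ⬝ᵥ B.mulVec z) ^ (2 * 2 ^ t) ≤ (z ⬝ᵥ z) ^ (2 * 2 ^ t) * (B ^ (2 * 2 ^ t)).trace := by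
  rcases Nat.eq_zero_or_pos t with rfl | ht
  · simpa using quadForm_sq_le_trace hB z
  have h1 := quadForm_pow_two_pow_le hB z t
  have h2 := quadForm_sq_le_trace (hB.pow (2 ^ t)) z
  have he : Even (2 ^ t) := (Nat.even_pow.2 ⟨even_two, ht.ne'⟩)
  have h3 := pow_le_pow_left₀ (mul_nonneg (he.pow_nonneg _) hz.le) h1 2
  rw [← pow_mul] at h2
  have h4 : (z ⬝ᵥ z) ^ 2 * (z ⬝ᵥ B.mulVec z) ^ (2 * 2 ^ t) ≤
      (z ⬝ᵥ z) ^ 2 * ((z ⬝ᵥ z) ^ (2 * 2 ^ t) * (B ^ (2 * 2 ^ t)).trace) := by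
    calc _ = ((z ⬝ᵥ B.mulVec z) ^ (2 ^ t) * (z ⬝ᵥ z)) ^ 2 := by ring
      _ ≤ _ := h3
      _ = (z ⬝ᵥ z) ^ (2 * 2 ^ t) * (z ⬝ᵥ (B ^ (2 ^ t)).mulVec z) ^ 2 := by ring
      _ ≤ (z ⬝ᵥ z) ^ (2 * 2 ^ t) * ((z ⬝ᵥ z) ^ 2 * (B ^ (2 ^ t * 2)).trace) := by gcongr
      _ = _ := by rw [mul_comm (2 ^ t) 2]; ring
  exact le_of_mul_le_mul_left h4 (by positivity)

lemma exists_two_pow_between {x : ℝ} (hx : 0 ≤ x) :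
    ∃ t : ℕ, x ≤ ((2 ^ t : ℕ) : ℝ) ∧ ((2 ^ t : ℕ) : ℝ) ≤ 2 * (x + 1) := by
  obtain ⟨t, h1, h2⟩ := exists_nat_pow_near (x := x + 1) (y := (2 : ℝ)) (by linarith) (by norm_num)
  refine ⟨t + 1, ?_, ?_⟩
  · push_cast; linarith
  · push_cast; rw [pow_succ]; linarith

/-- A Khintchine-type inequality for signed sums of symmetric matrices with bounded row sums,
tested against sign vectors which may depend on the signs. -/
lemma sum_quadForm_le_of_isSymm {ι Ω : Type*} [Fintype ι] [DecidableEq ι] [Fintype Ω]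
    [DecidableEq Ω] [Nonempty Ω] (B : ι → Matrix Ω Ω ℝ) (hs : ∀ i, (B i).IsSymm) {Δ : ℝ}
    (hΔ : 0 ≤ Δ) (hB : ∀ i S, ∑ T, |B i S T| ≤ Δ) (z : (ι → ℤˣ) → Ω → ℝ)
    (hz : ∀ b S, z b S * z b S = 1) :
    ∑ b : ι → ℤˣ, ∑ i, sgn (b i) * (z b ⬝ᵥ (B i).mulVec (z b)) ≤
      2 ^ Fintype.card ι * (Fintype.card Ω * Δ *
        Real.sqrt (32 * Fintype.card ι * (Real.log (Fintype.card Ω) + 1))) := by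
  rcases isEmpty_or_nonempty ι with hι | hι
  · simp
  set N : ℝ := ((Fintype.card Ω : ℕ) : ℝ) with hN
  set k : ℝ := ((Fintype.card ι : ℕ) : ℝ) with hk
  have hN1 : 1 ≤ N := by rw [hN]; exact_mod_cast Fintype.card_pos
  have hk1 : 1 ≤ k := by rw [hk]; exact_mod_cast Fintype.card_pos
  have hlog : 0 ≤ Real.log N := Real.log_nonneg hN1
  -- With `log N ≤ p`, the dimension factor `N` lost in the trace is at most `e ^ p`, a constant
  -- after the `2p`-th root. The upper bound on `p` yields the logarithm under the square root.
  obtain ⟨t, ht1, ht2⟩ := exists_two_pow_between hlog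
  set p := 2 ^ t with hp
  have hp0 : 0 < p := by positivity
  have hzz : ∀ b, z b ⬝ᵥ z b = N := fun b => by simp [dotProduct, hz, hN]
  set F : (ι → ℤˣ) → ℝ := fun b => ∑ i, sgn (b i) * (z b ⬝ᵥ (B i).mulVec (z b)) with hF
  have hFB : ∀ b, F b = z b ⬝ᵥ (∑ i, sgn (b i) • B i).mulVec (z b) := by
    intro b
    rw [Matrix.sum_mulVec, dotProduct_sum]
    simp [hF, Matrix.smul_mulVec, dotProduct_smul]
  have hsymm : ∀ b : ι → ℤˣ, (∑ i, sgn (b i) • B i).IsSymm := by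
    intro b
    rw [Matrix.IsSymm, Matrix.transpose_sum]
    exact sum_congr rfl fun i _ => by rw [Matrix.transpose_smul, (hs i).eq]
  set M : ℝ := 2 ^ Fintype.card ι with hM
  have hM0 : 0 < M := by positivity
  have hcard : (#(univ : Finset (ι → ℤˣ)) : ℝ) = M := by rw [card_univ, card_signs]
  have hpow : (∑ b, F b) ^ (2 * p) ≤ M ^ (2 * p) * (N ^ (2 * p) * (N * (Δ ^ (2 * p) *
      (2 * Real.exp 1 * p * k) ^ p))) := by
    have h2 : (∑ b, F b) ^ (2 * p) ≤ M ^ (2 * p - 1) * ∑ b, F b ^ (2 * p) := by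
      have := pow_sum_div_card_le_sum_pow (s := (univ : Finset (ι → ℤˣ))) (f := fun b => |F b|)
        (n := 2 * p - 1) (fun _ _ => abs_nonneg _)
      rw [hcard, Nat.sub_add_cancel (by omega), div_le_iff₀ (by positivity),
        mul_comm _ (M ^ (2 * p - 1))] at this
      simp_rw [(even_two_mul p).pow_abs] at this
      refine le_trans ?_ this
      rw [← (even_two_mul p).pow_abs]
      exact pow_le_pow_left₀ (abs_nonneg _) (abs_sum_le_sum_abs _ _) _
    have h3 : ∑ b, F b ^ (2 * p) ≤ M * (N ^ (2 * p) * (N * (Δ ^ (2 * p) *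
        (2 * Real.exp 1 * p * k) ^ p))) := by
      calc ∑ b, F b ^ (2 * p)
          ≤ ∑ b : ι → ℤˣ, N ^ (2 * p) * ((∑ i, sgn (b i) • B i) ^ (2 * p)).trace := by
            refine sum_le_sum fun b _ => ?_
            have := quadForm_pow_le_trace (hsymm b) (z b) (by rw [hzz]; linarith) t
            rw [hzz] at this
            rw [hFB]
            exact this
        _ ≤ N ^ (2 * p) * (N * (Δ ^ (2 * p) * (M * (2 * Real.exp 1 * p * k) ^ p))) := by
            rw [← mul_sum]
            gcongr
            refine (sum_trace_pow_le B hB (2 * p)).trans ?_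
            gcongr
            exact sum_signs_pow_le hp0
        _ = _ := by ring
    calc _ ≤ _ := h2
      _ ≤ _ := mul_le_mul_of_nonneg_left h3 (by positivity)
      _ = _ := by
        rw [← mul_assoc, ← pow_succ, Nat.sub_add_cancel (by omega)]
  have hNp : N ≤ Real.exp 1 ^ p := by
    rw [← Real.exp_nat_mul, mul_one, ← Real.log_le_iff_le_exp (by linarith)]
    exact ht1
  have hexp : Real.exp 1 ^ 2 ≤ 8 := by
    have := Real.exp_one_lt_d9
    have := Real.exp_pos 1
    nlinarith
  set R : ℝ := Real.sqrt (32 * k * (Real.log N + 1)) with hR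
  have hR2 : R ^ 2 = 32 * k * (Real.log N + 1) := Real.sq_sqrt (by positivity)
  have hfin : (∑ b, F b) ^ (2 * p) ≤ (M * (N * Δ * R)) ^ (2 * p) := by
    calc _ ≤ _ := hpow
      _ ≤ M ^ (2 * p) * (N ^ (2 * p) * (Real.exp 1 ^ p * (Δ ^ (2 * p) *
            (2 * Real.exp 1 * p * k) ^ p))) := by gcongr
      _ = M ^ (2 * p) * (N ^ (2 * p) * (Δ ^ (2 * p) * (Real.exp 1 ^ 2 * (2 * p * k)) ^ p)) := by
          rw [show Real.exp 1 ^ 2 * (2 * p * k) = Real.exp 1 * (2 * Real.exp 1 * p * k) by ring,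
            mul_pow (Real.exp 1)]
          ring
      _ ≤ M ^ (2 * p) * (N ^ (2 * p) * (Δ ^ (2 * p) * (R ^ 2) ^ p)) := by
          gcongr
          rw [hR2]
          calc Real.exp 1 ^ 2 * (2 * p * k) ≤ 8 * (2 * (2 * (Real.log N + 1)) * k) := by gcongr
            _ = _ := by ring
      _ = _ := by rw [← pow_mul R, mul_pow M, mul_pow (N * Δ), mul_pow N]; ring
  exact le_of_pow_le_pow_left₀ (by positivity) (by positivity) hfin

/-- The same inequality without symmetry, with bounded row and column sums. -/
lemma sum_quadForm_le {ι Ω : Type*} [Fintype ι] [DecidableEq ι] [Fintype Ω]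
    [DecidableEq Ω] [Nonempty Ω] (A : ι → Matrix Ω Ω ℝ) {Δ : ℝ} (hΔ : 0 ≤ Δ)
    (hrow : ∀ i S, ∑ T, |A i S T| ≤ Δ) (hcol : ∀ i T, ∑ S, |A i S T| ≤ Δ)
    (z : (ι → ℤˣ) → Ω → ℝ) (hz : ∀ b S, z b S * z b S = 1) :
    ∑ b : ι → ℤˣ, ∑ i, sgn (b i) * (z b ⬝ᵥ (A i).mulVec (z b)) ≤
      2 ^ Fintype.card ι * (Fintype.card Ω * Δ *
        Real.sqrt (32 * Fintype.card ι * (Real.log (Fintype.card Ω) + 1))) := by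
  have h := sum_quadForm_le_of_isSymm (fun i => (1 / 2 : ℝ) • (A i + (A i).transpose))
    (fun i => by
      rw [Matrix.IsSymm, Matrix.transpose_smul, Matrix.transpose_add, Matrix.transpose_transpose,
        add_comm]) hΔ
    (fun i S => by
      calc ∑ T, |((1 / 2 : ℝ) • (A i + (A i).transpose)) S T|
          ≤ ∑ T, (1 / 2 : ℝ) * (|A i S T| + |A i T S|) := by
            refine sum_le_sum fun T _ => ?_
            rw [Matrix.smul_apply, Matrix.add_apply, Matrix.transpose_apply, smul_eq_mul, abs_mul,
              abs_of_pos (by norm_num : (0 : ℝ) < 1 / 2)]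
            gcongr
            exact abs_add_le _ _
        _ ≤ Δ := by
            rw [← mul_sum, sum_add_distrib]
            linarith [hrow i S, hcol i S]) z hz
  refine le_trans (le_of_eq ?_) h
  refine sum_congr rfl fun b _ => sum_congr rfl fun i _ => ?_
  rw [Matrix.smul_mulVec, Matrix.add_mulVec, dotProduct_smul, dotProduct_add, smul_eq_mul]
  have : z b ⬝ᵥ (A i).transpose.mulVec (z b) = z b ⬝ᵥ (A i).mulVec (z b) := by
    rw [Matrix.mulVec_transpose, dotProduct_comm, ← Matrix.dotProduct_mulVec]
  rw [this]; ring

/-! ### Counting sequences with prescribed entries -/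

section Counting

variable {V : Type*} [Fintype V] [DecidableEq V]

lemma sum_apply_eq {J : Type*} [Fintype J] [DecidableEq J] (j : J) (u : V) (h : (J → V) → ℝ) :
    ∑ s : J → V, (if s j = u then h s else 0) =
      ∑ t : {l // l ≠ j} → V, h ((Equiv.funSplitAt j V).symm (u, t)) := by
  rw [← (Equiv.funSplitAt j V).symm.sum_comp, Fintype.sum_prod_type, sum_comm]
  refine sum_congr rfl fun t _ => ?_
  rw [sum_eq_single u]
  · simp
  · intro v _ hv; simp [hv]
  · simp

variable [Nonempty V]

lemma sum_indicator_apply_eq {J : Type*} [Fintype J] [DecidableEq J] (j : J) (u : V) :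
    ∑ s : J → V, (if s j = u then (1 : ℝ) else 0) =
      (Fintype.card V : ℝ) ^ Fintype.card J / Fintype.card V := by
  have hV : (Fintype.card V : ℝ) ≠ 0 := by exact_mod_cast Fintype.card_ne_zero
  have hJ : 0 < Fintype.card J := Fintype.card_pos_iff.2 ⟨j⟩
  rw [sum_apply_eq, sum_const, card_univ, Fintype.card_fun, Fintype.card_subtype_compl,
    Fintype.card_subtype_eq, eq_div_iff hV, nsmul_eq_mul, mul_one, Nat.cast_pow, ← pow_succ,
    Nat.sub_add_cancel hJ]

/-- Given that position `j₀` holds `u`, each of the other `m - 1` positions holds `v` with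
probability `1 / |V|`, while `j₀` itself holds `v` only if `v = u`. -/
lemma sum_indicator_pair_le {m : ℕ} (j₀ : Fin m) (u v : V) :
    ∑ s : Fin m → V, ∑ j, (if s j₀ = u then (1 : ℝ) else 0) * (if s j = v then 1 else 0) ≤
      (Fintype.card V : ℝ) ^ m / Fintype.card V *
        (m / Fintype.card V + if v = u then 1 else 0) := by
  set n : ℝ := ((Fintype.card V : ℕ) : ℝ) with hn
  have hV : 0 < n := by rw [hn]; exact_mod_cast Fintype.card_pos
  have hm : 0 < m := j₀.pos
  rw [sum_comm]
  have hself : ∑ s : Fin m → V, (if s j₀ = u then (1 : ℝ) else 0) * (if s j₀ = v then 1 else 0) ≤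
      n ^ m / n * if v = u then 1 else 0 := by
    have h := sum_indicator_apply_eq j₀ u
    rw [Fintype.card_fin, ← hn] at h
    rw [← h, sum_mul]
    refine sum_le_sum fun s _ => ?_
    split_ifs <;> simp_all
  have hother : ∀ j, j ≠ j₀ →
      ∑ s : Fin m → V, (if s j₀ = u then (1 : ℝ) else 0) * (if s j = v then 1 else 0) =
        n ^ m / n / n := by
    intro j hj
    have h1 : ∀ s : Fin m → V, (if s j₀ = u then (1 : ℝ) else 0) * (if s j = v then 1 else 0) =
        if s j₀ = u then (if s j = v then 1 else 0) else 0 := by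
      intro s; split_ifs <;> simp
    simp_rw [h1]
    rw [sum_apply_eq j₀ u fun s => if s j = v then 1 else 0]
    have h2 : ∀ t : {l // l ≠ j₀} → V,
        (Equiv.funSplitAt j₀ V).symm (u, t) j = t ⟨j, hj⟩ := by
      intro t; simp [hj]
    simp_rw [h2]
    rw [sum_indicator_apply_eq, Fintype.card_subtype_compl, Fintype.card_subtype_eq,
      Fintype.card_fin, ← hn, pow_sub₀ _ hV.ne' hm, pow_one, ← div_eq_mul_inv]
  rw [← add_sum_erase _ _ (mem_univ j₀), mul_add, add_comm (_ * (_ / _))]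
  refine add_le_add hself ?_
  rw [sum_congr rfl fun j hj => hother j (ne_of_mem_erase hj), sum_const,
    card_erase_of_mem (mem_univ _), card_univ, Fintype.card_fin, nsmul_eq_mul, Nat.cast_sub hm]
  have h3 : (0 : ℝ) ≤ n ^ m / n / n := by positivity
  have h4 : n ^ m / n * (m / n) = m * (n ^ m / n / n) := by ring
  rw [h4]
  push_cast
  nlinarith

variable {A : Type*} [Fintype A] [DecidableEq A]

lemma sum_indicator_slots {m : ℕ} (f : A → Fin m) (u : A → V) :
    ∑ S : A → Fin m → V, (if ∀ r, S r (f r) = u r then (1 : ℝ) else 0) =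
      ((Fintype.card V : ℝ) ^ m / Fintype.card V) ^ Fintype.card A := by
  simp_rw [← Fintype.prod_boole]
  have h := prod_univ_sum (fun _ : A => (univ : Finset (Fin m → V)))
    (fun r s => if s (f r) = u r then (1 : ℝ) else 0)
  rw [Fintype.piFinset_univ] at h
  rw [← h]
  simp_rw [sum_indicator_apply_eq, Fintype.card_fin]
  rw [prod_const, card_univ]

/-- Blocks are independent, so the one-block estimates multiply. -/
lemma sum_indicator_slots_pair_le {m : ℕ} (f : A → Fin m) (u v : A → V) :
    ∑ S : A → Fin m → V, ∑ f' : A → Fin m, (if ∀ r, S r (f r) = u r then (1 : ℝ) else 0) *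
        (if ∀ r, S r (f' r) = v r then (1 : ℝ) else 0) ≤
      ((Fintype.card V : ℝ) ^ m / Fintype.card V) ^ Fintype.card A *
        ∏ r, ((m : ℝ) / Fintype.card V + if v r = u r then 1 else 0) := by
  have h1 : ∀ S : A → Fin m → V, ∑ f' : A → Fin m, (if ∀ r, S r (f r) = u r then (1 : ℝ) else 0) *
        (if ∀ r, S r (f' r) = v r then (1 : ℝ) else 0) =
      ∏ r, ∑ j, (if S r (f r) = u r then (1 : ℝ) else 0) * (if S r j = v r then 1 else 0) := by
    intro S
    rw [prod_univ_sum, Fintype.piFinset_univ]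
    refine sum_congr rfl fun f' _ => ?_
    rw [prod_mul_distrib, Fintype.prod_boole, Fintype.prod_boole]
  simp_rw [h1]
  have h := prod_univ_sum (fun _ : A => (univ : Finset (Fin m → V)))
    (fun r s => ∑ j, (if s (f r) = u r then (1 : ℝ) else 0) * (if s j = v r then 1 else 0))
  rw [Fintype.piFinset_univ] at h
  rw [← h, ← card_univ (α := A), ← prod_const, ← prod_mul_distrib]
  refine prod_le_prod (fun r _ => ?_) fun r _ => sum_indicator_pair_le (f r) (u r) (v r)
  exact sum_nonneg fun _ _ => sum_nonneg fun _ _ => by split_ifs <;> simp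

end Counting

/-! ### Moving between sequences that differ in one entry per block -/

/-- Overwrite, in each block `r`, the entry at position `f r` by `v r`. -/
def overwrite {A V : Type*} {m : ℕ} (f : A → Fin m) (S : A → Fin m → V) (v : A → V) :
    A → Fin m → V := fun r => Function.update (S r) (f r) (v r)

section Overwrite

variable {A V : Type*} {m : ℕ}

lemma overwrite_apply (f : A → Fin m) (S : A → Fin m → V) (v : A → V) (r : A) :
    overwrite f S v r (f r) = v r := by simp [overwrite]

lemma overwrite_overwrite (f : A → Fin m) (S : A → Fin m → V) (u v : A → V)
    (h : ∀ r, S r (f r) = u r) : overwrite f (overwrite f S v) u = S := by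
  funext r
  simp only [overwrite, Function.update_idem]
  rw [← h r, Function.update_eq_self]

/-- Every entry left unchanged occurs in both products and cancels, since `x` squares to 1. -/
lemma prod_mul_prod_overwrite [Fintype A] {x : V → ℝ} (hx : ∀ v, x v * x v = 1) (f : A → Fin m)
    (S : A → Fin m → V) (v : A → V) :
    (∏ r, ∏ j, x (S r j)) * (∏ r, ∏ j, x (overwrite f S v r j)) =
      (∏ r, x (S r (f r))) * ∏ r, x (v r) := by
  rw [← prod_mul_distrib, ← prod_mul_distrib]
  refine prod_congr rfl fun r _ => ?_
  rw [← mul_prod_erase univ (fun j => x (S r j)) (mem_univ (f r)),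
    ← mul_prod_erase univ (fun j => x (overwrite f S v r j)) (mem_univ (f r)), overwrite_apply]
  have h1 : ∏ j ∈ univ.erase (f r), x (overwrite f S v r j) =
      ∏ j ∈ univ.erase (f r), x (S r j) :=
    prod_congr rfl fun j hj => by
      rw [overwrite, Function.update_of_ne (ne_of_mem_erase hj)]
  have h2 : (∏ j ∈ univ.erase (f r), x (S r j)) * ∏ j ∈ univ.erase (f r), x (S r j) = 1 := by
    rw [← prod_mul_distrib]
    exact prod_eq_one fun j _ => hx _
  rw [h1, mul_mul_mul_comm, h2, mul_one]

end Overwrite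

/-! ### Kikuchi matrices with vertices of large degree pruned -/

section Kikuchi

variable {V A Edge : Type*} [Fintype V] [DecidableEq V] [Nonempty V] [Fintype A] [DecidableEq A]
  [Fintype Edge]

/-- The weighted number of ways in which an edge can be placed on `S` along its end `α`. -/
def slotDegree {m : ℕ} (ν : Edge → ℝ) (α : Edge → A → V) (S : A → Fin m → V) : ℝ :=
  ∑ e, ∑ f : A → Fin m, ν e * if ∀ r, S r (f r) = α e r then 1 else 0

/-- Up to normalisation, this is the expected degree of a random vertex conditioned on containing
`u` along `f`; `hD` is precisely what bounds it. -/
lemma sum_slotDegree_le {m : ℕ} {ν : Edge → ℝ} (hν : ∀ e, 0 ≤ ν e) {α : Edge → A → V} {D : ℝ}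
    (hD : ∀ u : A → V, ∑ e, ν e * ∏ r, ((m : ℝ) / Fintype.card V + if α e r = u r then 1 else 0) ≤ D)
    (f : A → Fin m) (u : A → V) :
    ∑ S : A → Fin m → V, (if ∀ r, S r (f r) = u r then slotDegree ν α S else 0) ≤
      ((Fintype.card V : ℝ) ^ m / Fintype.card V) ^ Fintype.card A * D := by
  calc _ = ∑ e, ν e * ∑ S : A → Fin m → V, ∑ f' : A → Fin m,
        (if ∀ r, S r (f r) = u r then (1 : ℝ) else 0) *
          (if ∀ r, S r (f' r) = α e r then (1 : ℝ) else 0) := by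
        simp_rw [mul_sum]
        rw [sum_comm]
        refine sum_congr rfl fun S _ => ?_
        unfold slotDegree
        split_ifs
        · simp
        · simp
    _ ≤ ∑ e, ν e * (((Fintype.card V : ℝ) ^ m / Fintype.card V) ^ Fintype.card A *
        ∏ r, ((m : ℝ) / Fintype.card V + if α e r = u r then 1 else 0)) :=
        sum_le_sum fun e _ =>
          mul_le_mul_of_nonneg_left (sum_indicator_slots_pair_le f u (α e)) (hν e)
    _ = ((Fintype.card V : ℝ) ^ m / Fintype.card V) ^ Fintype.card A *
        ∑ e, ν e * ∏ r, ((m : ℝ) / Fintype.card V + if α e r = u r then 1 else 0) := by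
        rw [mul_sum]
        exact sum_congr rfl fun e _ => by ring
    _ ≤ _ := mul_le_mul_of_nonneg_left (hD u) (by positivity)

/-- Markov's inequality for the conditional expectation above. -/
lemma card_slotDegree_gt_le {m : ℕ} {ν : Edge → ℝ} (hν : ∀ e, 0 ≤ ν e) {α : Edge → A → V} {D : ℝ}
    (hD0 : 0 < D)
    (hD : ∀ u : A → V, ∑ e, ν e * ∏ r, ((m : ℝ) / Fintype.card V + if α e r = u r then 1 else 0) ≤ D)
    (f : A → Fin m) (u : A → V) :
    (#{S : A → Fin m → V | (∀ r, S r (f r) = u r) ∧ 4 * D < slotDegree ν α S} : ℝ) ≤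
      ((Fintype.card V : ℝ) ^ m / Fintype.card V) ^ Fintype.card A / 4 := by
  have hd0 : ∀ S : A → Fin m → V, 0 ≤ slotDegree ν α S := fun S =>
    sum_nonneg fun e _ => sum_nonneg fun f _ => mul_nonneg (hν e) (by split_ifs <;> simp)
  have h1 : (#{S : A → Fin m → V | (∀ r, S r (f r) = u r) ∧ 4 * D < slotDegree ν α S} : ℝ) *
      (4 * D) ≤ ∑ S : A → Fin m → V, (if ∀ r, S r (f r) = u r then slotDegree ν α S else 0) := by
    rw [← nsmul_eq_mul, ← sum_const, sum_filter]
    refine sum_le_sum fun S _ => ?_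
    by_cases h : ∀ r, S r (f r) = u r
    · by_cases h' : 4 * D < slotDegree ν α S
      · simp [h, h', h'.le]
      · simp [h, h', hd0]
    · simp [h]
  have h2 := h1.trans (sum_slotDegree_le hν hD f u)
  rw [le_div_iff₀ (by norm_num)]
  nlinarith

/-- The positions `S` at which an edge with ends `α₀, β₀` can be placed along `f` such that both
resulting vertices have small degree. -/
noncomputable def goodPlacements {m : ℕ} (ν : Edge → ℝ) (α β : Edge → A → V) (D : ℝ) (α₀ β₀ : A → V)
    (f : A → Fin m) : Finset (A → Fin m → V) :=
  open scoped Classical in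
  {S | (∀ r, S r (f r) = α₀ r) ∧ slotDegree ν α S ≤ 4 * D ∧
    slotDegree ν β (overwrite f S β₀) ≤ 4 * D}

omit [Nonempty V] in
lemma mem_goodPlacements {m : ℕ} {ν : Edge → ℝ} {α β : Edge → A → V} {D : ℝ} {α₀ β₀ : A → V}
    {f : A → Fin m} {S : A → Fin m → V} :
    S ∈ goodPlacements ν α β D α₀ β₀ f ↔ (∀ r, S r (f r) = α₀ r) ∧ slotDegree ν α S ≤ 4 * D ∧
      slotDegree ν β (overwrite f S β₀) ≤ 4 * D := by
  simp [goodPlacements]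

/-- Each of the two ends has too large a degree for at most a quarter of the placements, so at least
half survive. -/
lemma card_goodPlacements_ge {m : ℕ} {ν : Edge → ℝ} (hν : ∀ e, 0 ≤ ν e) {α β : Edge → A → V}
    {D : ℝ} (hD0 : 0 < D)
    (hα : ∀ u : A → V, ∑ e, ν e * ∏ r, ((m : ℝ) / Fintype.card V + if α e r = u r then 1 else 0) ≤ D)
    (hβ : ∀ u : A → V, ∑ e, ν e * ∏ r, ((m : ℝ) / Fintype.card V + if β e r = u r then 1 else 0) ≤ D)
    (f : A → Fin m) (α₀ β₀ : A → V) :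
    ((Fintype.card V : ℝ) ^ m / Fintype.card V) ^ Fintype.card A / 2 ≤
      (#(goodPlacements ν α β D α₀ β₀ f) : ℝ) := by
  classical
  have h1 := card_slotDegree_gt_le hν hD0 hα f α₀
  have h2 := card_slotDegree_gt_le hν hD0 hβ f β₀
  have h3 := sum_indicator_slots f α₀
  rw [sum_boole] at h3
  -- Writing `α₀` back undoes the overwriting, so bad `β`-ends are counted by the Markov bound at
  -- `β₀`.
  have h4 : #{S : A → Fin m → V | (∀ r, S r (f r) = α₀ r) ∧
      4 * D < slotDegree ν β (overwrite f S β₀)} ≤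
      #{S : A → Fin m → V | (∀ r, S r (f r) = β₀ r) ∧ 4 * D < slotDegree ν β S} := by
    refine card_le_card_of_injOn (fun S => overwrite f S β₀) ?_ ?_
    · intro S hS
      simp only [coe_filter, mem_univ, true_and, Set.mem_ofPred_eq] at hS ⊢
      exact ⟨fun r => overwrite_apply f S β₀ r, hS.2⟩
    · intro S hS T hT h
      simp only [coe_filter, mem_univ, true_and, Set.mem_ofPred_eq] at hS hT
      rw [← overwrite_overwrite f S α₀ β₀ hS.1, ← overwrite_overwrite f T α₀ β₀ hT.1]
      simp only at h
      rw [h]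
  have h5 : ({S | ∀ r, S r (f r) = α₀ r} : Finset (A → Fin m → V)) ⊆
      goodPlacements ν α β D α₀ β₀ f ∪
        (({S | (∀ r, S r (f r) = α₀ r) ∧ 4 * D < slotDegree ν α S} : Finset (A → Fin m → V)) ∪
        ({S | (∀ r, S r (f r) = α₀ r) ∧ 4 * D < slotDegree ν β (overwrite f S β₀)} :
          Finset (A → Fin m → V))) := by
    intro S hS
    simp only [mem_union, mem_goodPlacements, mem_filter, mem_univ, true_and] at hS ⊢
    by_cases h : slotDegree ν α S ≤ 4 * D
    · by_cases h' : slotDegree ν β (overwrite f S β₀) ≤ 4 * D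
      · exact Or.inl ⟨hS, h, h'⟩
      · exact Or.inr (Or.inr ⟨hS, not_le.1 h'⟩)
    · exact Or.inr (Or.inl ⟨hS, not_le.1 h⟩)
  have h6 := (card_le_card h5).trans ((card_union_le _ _).trans
    (Nat.add_le_add_left (card_union_le _ _) _))
  have h7 : (#({S | ∀ r, S r (f r) = α₀ r} : Finset (A → Fin m → V)) : ℝ) ≤ _ :=
    Nat.cast_le.2 h6
  push_cast at h7
  have h4' : (_ : ℝ) ≤ _ := Nat.cast_le.2 h4
  rw [h3] at h7
  linarith

/-- The Kikuchi matrix of one colour: each edge, placed along each choice of positions, is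
restricted to its good placements and rescaled so that all edges keep the same total weight. -/
noncomputable def kikuchiMatrix {m : ℕ} (w ν : Edge → ℝ) (α β : Edge → A → V) (D : ℝ) :
    Matrix (A → Fin m → V) (A → Fin m → V) ℝ :=
  open scoped Classical in
  Matrix.of fun S T => ∑ e, ∑ f : A → Fin m,
    w e * (((Fintype.card V : ℝ) ^ m / Fintype.card V) ^ Fintype.card A /
      #(goodPlacements ν α β D (α e) (β e) f)) *
      if S ∈ goodPlacements ν α β D (α e) (β e) f ∧ T = overwrite f S (β e) then 1 else 0

section Matrix

variable {m : ℕ} {w ν : Edge → ℝ} (hw : ∀ e, |w e| ≤ ν e) {α β : Edge → A → V} {D : ℝ} (hD0 : 0 < D)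
    (hα : ∀ u : A → V, ∑ e, ν e * ∏ r, ((m : ℝ) / Fintype.card V + if α e r = u r then 1 else 0) ≤ D)
    (hβ : ∀ u : A → V, ∑ e, ν e * ∏ r, ((m : ℝ) / Fintype.card V + if β e r = u r then 1 else 0) ≤ D)

include hw hD0 hα hβ

lemma abs_weight_le (e : Edge) (f : A → Fin m) :
    |w e * (((Fintype.card V : ℝ) ^ m / Fintype.card V) ^ Fintype.card A /
      #(goodPlacements ν α β D (α e) (β e) f))| ≤ ν e * 2 := by
  have hV : (0 : ℝ) < Fintype.card V := by exact_mod_cast Fintype.card_pos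
  have h := card_goodPlacements_ge (fun e => (abs_nonneg _).trans (hw e)) hD0 hα hβ f (α e) (β e)
  set M : ℝ := ((Fintype.card V : ℝ) ^ m / Fintype.card V) ^ Fintype.card A
  have hM : 0 < M := by positivity
  rw [abs_mul]
  refine mul_le_mul (hw e) ?_ (abs_nonneg _) ((abs_nonneg _).trans (hw e))
  rw [abs_of_nonneg (by positivity), div_le_iff₀ (by linarith)]
  linarith

/-- A row with degree above `4 * D` has been pruned to zero. In any other row the rescaling, by a
factor at most 2, gives at most twice the degree. -/
lemma kikuchiMatrix_row_le (S : A → Fin m → V) :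
    ∑ T, |kikuchiMatrix w ν α β D S T| ≤ 8 * D := by
  classical
  calc ∑ T, |kikuchiMatrix w ν α β D S T|
      ≤ ∑ T, ∑ e, ∑ f : A → Fin m, (ν e * 2) *
          if S ∈ goodPlacements ν α β D (α e) (β e) f ∧ T = overwrite f S (β e) then 1 else 0 := by
        refine sum_le_sum fun T _ => ?_
        rw [kikuchiMatrix, Matrix.of_apply]
        refine (abs_sum_le_sum_abs _ _).trans (sum_le_sum fun e _ => ?_)
        refine (abs_sum_le_sum_abs _ _).trans (sum_le_sum fun f _ => ?_)
        rw [abs_mul]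
        refine mul_le_mul (abs_weight_le hw hD0 hα hβ e f) (le_of_eq ?_) (abs_nonneg _)
          (mul_nonneg ((abs_nonneg _).trans (hw e)) zero_le_two)
        split_ifs <;> simp
    _ = ∑ e, ∑ f : A → Fin m, (ν e * 2) *
          if S ∈ goodPlacements ν α β D (α e) (β e) f then 1 else 0 := by
        rw [sum_comm]
        refine sum_congr rfl fun e _ => ?_
        rw [sum_comm]
        refine sum_congr rfl fun f _ => ?_
        rw [← mul_sum]
        by_cases h : S ∈ goodPlacements ν α β D (α e) (β e) f <;> simp [h]
    _ ≤ 8 * D := by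
        by_cases hS : slotDegree ν α S ≤ 4 * D
        · calc _ ≤ ∑ e, ∑ f : A → Fin m, 2 * (ν e * if ∀ r, S r (f r) = α e r then 1 else 0) := by
                refine sum_le_sum fun e _ => sum_le_sum fun f _ => ?_
                rw [mul_comm (ν e), mul_assoc]
                refine mul_le_mul_of_nonneg_left (mul_le_mul_of_nonneg_left ?_
                  ((abs_nonneg _).trans (hw e))) zero_le_two
                by_cases h : S ∈ goodPlacements ν α β D (α e) (β e) f
                · simp [h, (mem_goodPlacements.1 h).1]
                · simp only [h, if_false]; split_ifs <;> simp
            _ = 2 * slotDegree ν α S := by simp_rw [slotDegree, mul_sum]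
            _ ≤ 8 * D := by linarith
        · have h0 : ∀ (e : Edge) (f : A → Fin m), S ∉ goodPlacements ν α β D (α e) (β e) f :=
            fun e f h => hS (mem_goodPlacements.1 h).2.1
          simp [h0, hD0.le]

/-- The row argument with `β` in place of `α`: for given `e` and `f`, the column index determines
the row index by writing `α e` back. -/
lemma kikuchiMatrix_col_le (T : A → Fin m → V) :
    ∑ S, |kikuchiMatrix w ν α β D S T| ≤ 8 * D := by
  classical
  calc ∑ S, |kikuchiMatrix w ν α β D S T|
      ≤ ∑ S, ∑ e, ∑ f : A → Fin m, (ν e * 2) *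
          if S = overwrite f T (α e) then
            (if (∀ r, T r (f r) = β e r) ∧ slotDegree ν β T ≤ 4 * D then 1 else 0) else 0 := by
        refine sum_le_sum fun S _ => ?_
        rw [kikuchiMatrix, Matrix.of_apply]
        refine (abs_sum_le_sum_abs _ _).trans (sum_le_sum fun e _ => ?_)
        refine (abs_sum_le_sum_abs _ _).trans (sum_le_sum fun f _ => ?_)
        rw [abs_mul]
        refine mul_le_mul (abs_weight_le hw hD0 hα hβ e f) ?_ (abs_nonneg _)
          (mul_nonneg ((abs_nonneg _).trans (hw e)) zero_le_two)
        by_cases h : S ∈ goodPlacements ν α β D (α e) (β e) f ∧ T = overwrite f S (β e)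
        · obtain ⟨hS, rfl⟩ := h
          have hS' := mem_goodPlacements.1 hS
          rw [overwrite_overwrite f S _ _ hS'.1]
          simp [hS, hS'.2.2, overwrite_apply]
        · simp only [h, if_false, abs_zero]
          split_ifs <;> simp
    _ = ∑ e, ∑ f : A → Fin m, (ν e * 2) *
          if (∀ r, T r (f r) = β e r) ∧ slotDegree ν β T ≤ 4 * D then 1 else 0 := by
        rw [sum_comm]
        refine sum_congr rfl fun e _ => ?_
        rw [sum_comm]
        refine sum_congr rfl fun f _ => ?_
        rw [← mul_sum, sum_ite_eq' univ, if_pos (mem_univ _)]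
    _ ≤ 8 * D := by
        by_cases hT : slotDegree ν β T ≤ 4 * D
        · calc _ = 2 * slotDegree ν β T := by
                simp only [hT, and_true]
                rw [slotDegree, mul_sum]
                refine sum_congr rfl fun e _ => ?_
                rw [mul_sum]
                exact sum_congr rfl fun f _ => by ring
            _ ≤ 8 * D := by linarith
        · simp [hT, hD0.le]

/-- Each surviving placement contributes the monomial itself, and the rescaling restores the mass
removed by pruning. The identity is therefore exact, with `m ^ |A|` choices of positions per edge.
-/
lemma quadForm_kikuchiMatrix {x : V → ℝ} (hx : ∀ v, x v * x v = 1) :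
    (fun S : A → Fin m → V => ∏ r, ∏ j, x (S r j)) ⬝ᵥ
        (kikuchiMatrix w ν α β D).mulVec (fun S : A → Fin m → V => ∏ r, ∏ j, x (S r j)) =
      ((Fintype.card V : ℝ) ^ m / Fintype.card V) ^ Fintype.card A * m ^ Fintype.card A *
        ∑ e, w e * ((∏ r, x (α e r)) * ∏ r, x (β e r)) := by
  classical
  have hV : (0 : ℝ) < Fintype.card V := by exact_mod_cast Fintype.card_pos
  set M : ℝ := ((Fintype.card V : ℝ) ^ m / Fintype.card V) ^ Fintype.card A with hM
  have hM0 : 0 < M := by positivity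
  set z : (A → Fin m → V) → ℝ := fun S => ∏ r, ∏ j, x (S r j) with hz
  calc z ⬝ᵥ (kikuchiMatrix w ν α β D).mulVec z
      = ∑ S, ∑ T, ∑ e, ∑ f : A → Fin m, w e * (M / #(goodPlacements ν α β D (α e) (β e) f)) *
          (if S ∈ goodPlacements ν α β D (α e) (β e) f then
            (if T = overwrite f S (β e) then z S * z T else 0) else 0) := by
        rw [dotProduct]
        refine sum_congr rfl fun S _ => ?_
        rw [Matrix.mulVec, dotProduct, mul_sum]
        refine sum_congr rfl fun T _ => ?_
        rw [kikuchiMatrix, Matrix.of_apply, sum_mul, mul_sum]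
        refine sum_congr rfl fun e _ => ?_
        rw [sum_mul, mul_sum]
        refine sum_congr rfl fun f _ => ?_
        by_cases h : S ∈ goodPlacements ν α β D (α e) (β e) f <;>
          by_cases h' : T = overwrite f S (β e) <;> simp only [h, h', and_true, and_false,
            if_true, if_false, and_self] <;> ring
    _ = ∑ e, ∑ f : A → Fin m, w e * (M / #(goodPlacements ν α β D (α e) (β e) f)) *
          ∑ S ∈ goodPlacements ν α β D (α e) (β e) f, z S * z (overwrite f S (β e)) := by
        have h1 : ∀ (e : Edge) (f : A → Fin m) (S : A → Fin m → V), ∑ T,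
            w e * (M / #(goodPlacements ν α β D (α e) (β e) f)) *
            (if S ∈ goodPlacements ν α β D (α e) (β e) f then
              (if T = overwrite f S (β e) then z S * z T else 0) else 0) =
            w e * (M / #(goodPlacements ν α β D (α e) (β e) f)) *
              if S ∈ goodPlacements ν α β D (α e) (β e) f then
                z S * z (overwrite f S (β e)) else 0 := by
          intro e f S
          rw [← mul_sum]
          split_ifs <;> simp
        calc _ = ∑ S, ∑ e, ∑ f : A → Fin m, ∑ T,
            w e * (M / #(goodPlacements ν α β D (α e) (β e) f)) *
            (if S ∈ goodPlacements ν α β D (α e) (β e) f then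
              (if T = overwrite f S (β e) then z S * z T else 0) else 0) := by
              refine sum_congr rfl fun S _ => ?_
              rw [sum_comm]
              refine sum_congr rfl fun e _ => ?_
              rw [sum_comm]
          _ = _ := by
              simp_rw [h1]
              rw [sum_comm]
              refine sum_congr rfl fun e _ => ?_
              rw [sum_comm]
              refine sum_congr rfl fun f _ => ?_
              rw [← mul_sum, sum_ite_mem, univ_inter]
    _ = ∑ e, ∑ f : A → Fin m, w e * M * ((∏ r, x (α e r)) * ∏ r, x (β e r)) := by
        refine sum_congr rfl fun e _ => sum_congr rfl fun f _ => ?_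
        have h := card_goodPlacements_ge (fun e => (abs_nonneg _).trans (hw e)) hD0 hα hβ f
          (α e) (β e)
        rw [← hM] at h
        have h' : (0 : ℝ) < #(goodPlacements ν α β D (α e) (β e) f) := by linarith
        have hS : ∀ S ∈ goodPlacements ν α β D (α e) (β e) f,
            z S * z (overwrite f S (β e)) = (∏ r, x (α e r)) * ∏ r, x (β e r) := by
          intro S hS
          rw [hz]
          simp only
          rw [prod_mul_prod_overwrite hx]
          simp_rw [(mem_goodPlacements.1 hS).1]
        rw [sum_congr rfl hS, sum_const, nsmul_eq_mul]
        field_simp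
    _ = _ := by
        simp only [sum_const, card_univ, Fintype.card_fun, Fintype.card_fin, nsmul_eq_mul]
        rw [mul_sum]
        refine sum_congr rfl fun e _ => ?_
        push_cast; ring

end Matrix

/-- The Kikuchi bound: refutation of a randomly signed sum of weighted monomials, each split into
two halves `α e` and `β e`, under the degree conditions on the halves. -/
lemma sum_signed_monomials_le {ι : Type*} [Fintype ι] [DecidableEq ι] {m : ℕ}
    {w ν : ι → Edge → ℝ} (hw : ∀ i e, |w i e| ≤ ν i e) {α β : Edge → A → V} {D : ℝ} (hD0 : 0 < D)
    (hα : ∀ i, ∀ u : A → V,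
      ∑ e, ν i e * ∏ r, ((m : ℝ) / Fintype.card V + if α e r = u r then 1 else 0) ≤ D)
    (hβ : ∀ i, ∀ u : A → V,
      ∑ e, ν i e * ∏ r, ((m : ℝ) / Fintype.card V + if β e r = u r then 1 else 0) ≤ D)
    (x : (ι → ℤˣ) → V → ℝ) (hx : ∀ b v, x b v * x b v = 1) :
    ((m : ℝ) / Fintype.card V) ^ Fintype.card A * ∑ b : ι → ℤˣ, ∑ i, sgn (b i) *
        ∑ e, w i e * ((∏ r, x b (α e r)) * ∏ r, x b (β e r)) ≤
      2 ^ Fintype.card ι * (8 * D * Real.sqrt (32 * Fintype.card ι *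
        (Fintype.card A * m * Real.log (Fintype.card V) + 1))) := by
  have hV : (0 : ℝ) < Fintype.card V := by exact_mod_cast Fintype.card_pos
  have h := sum_quadForm_le (fun i => kikuchiMatrix (m := m) (w i) (ν i) α β D)
    (Δ := 8 * D) (by positivity)
    (fun i S => kikuchiMatrix_row_le (hw i) hD0 (hα i) (hβ i) S)
    (fun i T => kikuchiMatrix_col_le (hw i) hD0 (hα i) (hβ i) T)
    (fun b S => ∏ r, ∏ j, x b (S r j))
    (fun b S => by
      rw [← prod_mul_distrib]
      refine prod_eq_one fun r _ => ?_
      rw [← prod_mul_distrib]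
      exact prod_eq_one fun j _ => hx _ _)
  simp_rw [fun (b : ι → ℤˣ) (i : ι) =>
    quadForm_kikuchiMatrix (hw i) hD0 (hα i) (hβ i) (hx b)] at h
  have hN : (Fintype.card (A → Fin m → V) : ℝ) = ((Fintype.card V : ℝ) ^ m) ^ Fintype.card A := by
    simp
  rw [hN, Real.log_pow, Real.log_pow, ← mul_assoc (Fintype.card A : ℝ)] at h
  set P : ℝ := ((Fintype.card V : ℝ) ^ m) ^ Fintype.card A with hP
  have hP0 : 0 < P := by positivity
  -- Dividing by the number `P` of vertices leaves the density `(m / |V|) ^ |A|` on the left.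
  refine le_of_mul_le_mul_left ?_ hP0
  calc _ = _ := ?_
    _ ≤ _ := h
    _ = _ := by ring
  rw [mul_sum, mul_sum]
  refine sum_congr rfl fun b _ => ?_
  rw [mul_sum, mul_sum]
  refine sum_congr rfl fun i _ => ?_
  rw [div_pow, div_pow, ← hP]
  ring

end Kikuchi

/-! ### Degrees of tuples and spread of pairs of tuples -/

section Degree

variable {ι V : Type*} [Fintype ι] [Fintype V] [DecidableEq V] {q : ℕ}

/-- Total weight, over all colours, of the tuples which agree with `C` on the slots `P`. -/
noncomputable def tupleDegree (p : ι → (Fin q → V) → ℝ) (P : Finset (Fin q)) (C : Fin q → V) : ℝ :=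
  ∑ C', if ∀ r ∈ P, C' r = C r then ∑ i, |p i C'| else 0

omit [Fintype V] [DecidableEq V] in
lemma sum_abs_nonneg (p : ι → (Fin q → V) → ℝ) (C : Fin q → V) : 0 ≤ ∑ i, |p i C| :=
  sum_nonneg fun _ _ => abs_nonneg _

lemma tupleDegree_nonneg (p : ι → (Fin q → V) → ℝ) (P : Finset (Fin q)) (C : Fin q → V) :
    0 ≤ tupleDegree p P C :=
  sum_nonneg fun C' _ => by
    split_ifs
    exacts [sum_abs_nonneg p C', le_rfl]

lemma tupleDegree_congr (p : ι → (Fin q → V) → ℝ) {P : Finset (Fin q)} {C C' : Fin q → V}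
    (h : ∀ r ∈ P, C r = C' r) : tupleDegree p P C = tupleDegree p P C' := by
  refine sum_congr rfl fun C'' _ => ?_
  have : (∀ r ∈ P, C'' r = C r) ↔ ∀ r ∈ P, C'' r = C' r :=
    forall₂_congr fun r hr => by rw [h r hr]
  simp only [this]

lemma sum_abs_le_tupleDegree (p : ι → (Fin q → V) → ℝ) (P : Finset (Fin q)) (C : Fin q → V) :
    ∑ i, |p i C| ≤ tupleDegree p P C := by
  have h := single_le_sum (f := fun C' => if ∀ r ∈ P, C' r = C r then ∑ i, |p i C'| else 0)
    (fun C' _ => by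
      split_ifs
      exacts [sum_abs_nonneg p C', le_rfl]) (mem_univ C)
  rwa [if_pos fun _ _ => rfl] at h

/-- Reference value for the degree of a set of `s` slots; here `κ` is the square root of the
density. -/
def slotScale (q : ℕ) (κ : ℝ) (s : ℕ) : ℝ := κ ^ min (2 * s) q

lemma slotScale_pos {κ : ℝ} (hκ : 0 < κ) (q s : ℕ) : 0 < slotScale q κ s := pow_pos hκ _

/-- The weight of a pair of tuples of a given colour: choose the first one with its own weight,
and the second one proportionally to its total weight among the tuples agreeing with it on `P`. -/
noncomputable def pairWeight (p : ι → (Fin q → V) → ℝ) (G : Finset (Fin q → V)) (P : Finset (Fin q))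
    (i : ι) (e : (Fin q → V) × (Fin q → V)) : ℝ :=
  if e.1 ∈ G ∧ e.2 ∈ G ∧ ∀ r ∈ P, e.2 r = e.1 r then
    |p i e.1| * (∑ j, |p j e.2|) / tupleDegree p P e.1 else 0

lemma pairWeight_nonneg (p : ι → (Fin q → V) → ℝ) (G : Finset (Fin q → V)) (P : Finset (Fin q))
    (i : ι) (e : (Fin q → V) × (Fin q → V)) : 0 ≤ pairWeight p G P i e := by
  unfold pairWeight
  split_ifs
  · exact div_nonneg (mul_nonneg (abs_nonneg _) (sum_abs_nonneg p _)) (tupleDegree_nonneg p _ _)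
  · exact le_rfl

lemma sum_agree_le {w : (Fin q → V) → ℝ} (hw : ∀ C, 0 ≤ w C) {τ : ℝ}
    (h : ∀ r v, ∑ C, (if C r = v then w C else 0) ≤ τ) {R : Finset (Fin q)} (hR : R.Nonempty)
    (u : Fin q → V) : ∑ C, (if ∀ r ∈ R, C r = u r then w C else 0) ≤ τ := by
  obtain ⟨r, hr⟩ := hR
  refine le_trans (sum_le_sum fun C _ => ?_) (h r (u r))
  by_cases h1 : ∀ r ∈ R, C r = u r
  · rw [if_pos h1, if_pos (h1 r hr)]
  · simp only [h1, if_false]; split_ifs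
    exacts [hw C, le_rfl]

variable {p : ι → (Fin q → V) → ℝ} {τ κ : ℝ} {G : Finset (Fin q → V)} {P : Finset (Fin q)}

/-- Fix the second tuple. Smoothness bounds the mass of matching first tuples by `τ ≤ slotScale q κ
#P`, and maximality of `P` replaces division by its `P`-degree with `κ ^ (2 * #R)` over its
`R`-degree. Summing over second tuples cancels the `R`-degree. -/
lemma sum_pairWeight_snd_le (hκ : 0 < κ) (hτ : τ ≤ κ ^ q) (hκ1 : κ ≤ 1)
    (hp : ∀ i r v, ∑ C, (if C r = v then |p i C| else 0) ≤ τ) (hP : P.Nonempty)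
    (hdeg : ∀ C ∈ G, 0 < tupleDegree p P C)
    (hmax : ∀ C ∈ G, ∀ R : Finset (Fin q), R.Nonempty →
      tupleDegree p R C * slotScale q κ #P ≤ tupleDegree p P C * slotScale q κ #R)
    (i : ι) {R : Finset (Fin q)} (hR : R.Nonempty) (hRq : 2 * #R ≤ q) (u : Fin q → V) :
    ∑ C', ∑ C, (if ∀ r ∈ R, C' r = u r then pairWeight p G P i (C, C') else 0) ≤ κ ^ (2 * #R) := by
  have hθP : 0 < slotScale q κ #P := slotScale_pos hκ q _
  have hθR : slotScale q κ #R = κ ^ (2 * #R) := by rw [slotScale, min_eq_left hRq]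
  have hτP : τ ≤ slotScale q κ #P :=
    hτ.trans (pow_le_pow_of_le_one hκ.le hκ1 (min_le_right _ _))
  have hτ0 : 0 ≤ τ := (sum_nonneg fun C _ => by split_ifs; exacts [abs_nonneg _, le_rfl]).trans
    (hp i hP.choose (u hP.choose))
  set d := tupleDegree p R u with hd
  have hd0 : 0 ≤ d := tupleDegree_nonneg _ _ _
  have hinner : ∀ C', ∑ C, (if ∀ r ∈ R, C' r = u r then pairWeight p G P i (C, C') else 0) ≤
      (if ∀ r ∈ R, C' r = u r then ∑ j, |p j C'| else 0) * (κ ^ (2 * #R) / d) := by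
    intro C'
    by_cases h : ∀ r ∈ R, C' r = u r
    swap
    · simp [h]
    simp only [if_pos h]
    by_cases hC' : C' ∈ G
    swap
    · simp only [pairWeight, hC', false_and, and_false, if_false, sum_const_zero]
      exact mul_nonneg (sum_abs_nonneg p C') (by positivity)
    have hdC : tupleDegree p R C' = d := tupleDegree_congr p h
    have hP' := hdeg C' hC'
    have h1 : ∑ C, pairWeight p G P i (C, C') ≤
        (∑ C, if ∀ r ∈ P, C r = C' r then |p i C| else 0) *
          ((∑ j, |p j C'|) / tupleDegree p P C') := by
      rw [sum_mul]
      refine sum_le_sum fun C _ => ?_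
      unfold pairWeight
      by_cases hc : C ∈ G ∧ C' ∈ G ∧ ∀ r ∈ P, C' r = C r
      · have h2 : ∀ r ∈ P, C r = C' r := fun r hr => (hc.2.2 r hr).symm
        rw [if_pos hc, if_pos h2, tupleDegree_congr p h2, mul_div_assoc]
      · rw [if_neg hc]
        refine mul_nonneg ?_ (div_nonneg (sum_abs_nonneg p C') hP'.le)
        split_ifs
        exacts [abs_nonneg _, le_rfl]
    refine h1.trans ?_
    refine (mul_le_mul_of_nonneg_right (sum_agree_le (fun C => abs_nonneg _) (hp i) hP C')
      (div_nonneg (sum_abs_nonneg p C') hP'.le)).trans ?_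
    rw [mul_div_assoc', mul_comm τ, mul_div_assoc]
    rcases hd0.eq_or_lt with h0 | h0
    · have : ∑ j, |p j C'| = 0 := le_antisymm
        ((sum_abs_le_tupleDegree p R C').trans (by rw [hdC, ← h0])) (sum_abs_nonneg p C')
      simp [this]
    refine mul_le_mul_of_nonneg_left ?_ (sum_abs_nonneg p C')
    rw [div_le_div_iff₀ hP' h0]
    have h3 := hmax C' hC' R hR
    rw [hdC, hθR] at h3
    calc τ * d ≤ slotScale q κ #P * d := by gcongr
      _ ≤ _ := by linarith
  refine (sum_le_sum fun C' _ => hinner C').trans ?_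
  rw [← sum_mul]
  change d * _ ≤ _
  rcases hd0.eq_or_lt with h0 | h0
  · rw [← h0, zero_mul]; positivity
  · rw [mul_div_cancel₀ _ h0.ne']

/-- The admissible second tuples all agree on `P ∪ R` with any one of them, so their mass is at most
a `P ∪ R`-degree, which maximality of `P` compares with the `P`-degree. -/
lemma sum_pairWeight_fixed_fst_le (hκ : 0 < κ)
    (hdeg : ∀ C ∈ G, 0 < tupleDegree p P C)
    (hmax : ∀ C ∈ G, ∀ R : Finset (Fin q), R.Nonempty →
      tupleDegree p R C * slotScale q κ #P ≤ tupleDegree p P C * slotScale q κ #R)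
    (hP : P.Nonempty) (i : ι) {R : Finset (Fin q)} (hPR : Disjoint P R) (u C : Fin q → V) :
    ∑ C', (if ∀ r ∈ R, C' r = u r then pairWeight p G P i (C, C') else 0) ≤
      |p i C| * (slotScale q κ (#P + #R) / slotScale q κ #P) := by
  have hθP : 0 < slotScale q κ #P := slotScale_pos hκ q _
  have hθ : 0 < slotScale q κ (#P + #R) := slotScale_pos hκ q _
  by_cases hne : ∃ C', C ∈ G ∧ C' ∈ G ∧ (∀ r ∈ P, C' r = C r) ∧ ∀ r ∈ R, C' r = u r
  swap
  · have h0 : ∀ C', (if ∀ r ∈ R, C' r = u r then pairWeight p G P i (C, C') else 0) = 0 := by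
      intro C'
      by_cases h : ∀ r ∈ R, C' r = u r
      · rw [if_pos h, pairWeight, if_neg]
        exact fun hc => hne ⟨C', hc.1, hc.2.1, hc.2.2, h⟩
      · rw [if_neg h]
    rw [sum_congr rfl fun C' _ => h0 C', sum_const_zero]
    positivity
  obtain ⟨C₀, hC, hC₀, hP₀, hR₀⟩ := hne
  have hdC := hdeg C hC
  have h1 : ∑ C', (if ∀ r ∈ R, C' r = u r then pairWeight p G P i (C, C') else 0) ≤
      |p i C| / tupleDegree p P C * tupleDegree p (P ∪ R) C₀ := by
    rw [tupleDegree.eq_def p (P ∪ R), mul_sum]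
    refine sum_le_sum fun C' _ => ?_
    have hn : 0 ≤ |p i C| / tupleDegree p P C *
        if ∀ r ∈ P ∪ R, C' r = C₀ r then ∑ j, |p j C'| else 0 := by
      refine mul_nonneg (by positivity) ?_
      split_ifs
      exacts [sum_abs_nonneg p C', le_rfl]
    by_cases h : ∀ r ∈ R, C' r = u r
    swap
    · rw [if_neg h]; exact hn
    rw [if_pos h, pairWeight]
    split_ifs with hc h' h'
    · exact le_of_eq (by ring)
    · refine absurd (fun r hr => ?_) h'
      rcases mem_union.1 hr with hr | hr
      · rw [hP₀ r hr]; exact hc.2.2 r hr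
      · rw [h r hr, hR₀ r hr]
    · rw [if_pos h'] at hn; exact hn
    · simp
  refine h1.trans ?_
  have h2 := hmax C₀ hC₀ (P ∪ R) (hP.mono subset_union_left)
  rw [card_union_of_disjoint hPR, tupleDegree_congr p hP₀] at h2
  rw [div_mul_eq_mul_div, mul_div_assoc]
  refine mul_le_mul_of_nonneg_left ?_ (abs_nonneg _)
  rw [div_le_div_iff₀ hdC hθP]
  linarith

/-- If only `R₂` is nonempty, summing over the first tuple for a fixed second one suffices. If `R₁`
is nonempty, smoothness of the first tuple gives `κ ^ q`, and the conditional mass of the second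
gives a ratio of scales. -/
lemma sum_pairWeight_agree_le (hκ : 0 < κ) (hτ : τ ≤ κ ^ q) (hκ1 : κ ≤ 1)
    (hp1 : ∀ i, ∑ C, |p i C| ≤ 1)
    (hp : ∀ i r v, ∑ C, (if C r = v then |p i C| else 0) ≤ τ) (hP : P.Nonempty)
    (hdeg : ∀ C ∈ G, 0 < tupleDegree p P C)
    (hmax : ∀ C ∈ G, ∀ R : Finset (Fin q), R.Nonempty →
      tupleDegree p R C * slotScale q κ #P ≤ tupleDegree p P C * slotScale q κ #R)
    (i : ι) {R₁ R₂ : Finset (Fin q)} (h1 : 2 * #R₁ ≤ q) (h2 : 2 * #R₂ ≤ q) (h12 : Disjoint R₁ R₂)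
    (hP1 : Disjoint P R₁) (hP2 : Disjoint P R₂) (u : Fin q → V) :
    ∑ e : (Fin q → V) × (Fin q → V), pairWeight p G P i e *
      (if (∀ r ∈ R₁, e.1 r = u r) ∧ ∀ r ∈ R₂, e.2 r = u r then 1 else 0) ≤
        κ ^ (2 * (#R₁ + #R₂)) := by
  have hθP : 0 < slotScale q κ #P := slotScale_pos hκ q _
  rw [Fintype.sum_prod_type]
  by_cases hcase : R₁ = ∅ ∧ R₂.Nonempty
  · obtain ⟨rfl, hR⟩ := hcase
    refine le_trans (le_of_eq ?_)
      ((sum_pairWeight_snd_le hκ hτ hκ1 hp hP hdeg hmax i hR h2 u).trans (by simp))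
    rw [sum_comm]
    refine sum_congr rfl fun C' _ => sum_congr rfl fun C _ => ?_
    simp
  have hmain : ∑ C, ∑ C', pairWeight p G P i (C, C') *
      (if (∀ r ∈ R₁, C r = u r) ∧ ∀ r ∈ R₂, C' r = u r then 1 else 0) ≤
      (∑ C, if ∀ r ∈ R₁, C r = u r then |p i C| else 0) *
        (slotScale q κ (#P + #R₂) / slotScale q κ #P) := by
    rw [sum_mul]
    refine sum_le_sum fun C _ => ?_
    by_cases h : ∀ r ∈ R₁, C r = u r
    · rw [if_pos h]
      refine le_trans (le_of_eq (sum_congr rfl fun C' _ => ?_))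
        (sum_pairWeight_fixed_fst_le hκ hdeg hmax hP i hP2 u C)
      simp only [eq_true h, true_and, mul_ite, mul_one, mul_zero]
    · simp [h]
  refine hmain.trans ?_
  rcases R₁.eq_empty_or_nonempty with rfl | hR1
  · have hR2 : R₂ = ∅ := not_nonempty_iff_eq_empty.1 fun h => hcase ⟨rfl, h⟩
    subst hR2
    simpa [div_self hθP.ne'] using hp1 i
  · refine (mul_le_mul_of_nonneg_right (sum_agree_le (fun _ => abs_nonneg _) (hp i) hR1 u)
      (div_nonneg (slotScale_pos hκ _ _).le hθP.le)).trans ?_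
    refine (mul_le_mul_of_nonneg_right hτ
      (div_nonneg (slotScale_pos hκ _ _).le hθP.le)).trans ?_
    rw [← mul_div_assoc, div_le_iff₀ hθP, slotScale, slotScale, ← pow_add, ← pow_add]
    -- The exponents compare because `P`, `R₁`, `R₂` are disjoint in `q` slots and `2 * #R₁ ≤ q`;
    -- here the truncation of the scale at `q` matters.
    refine pow_le_pow_of_le_one hκ.le hκ1 ?_
    have hc : #P + #R₁ + #R₂ ≤ q := by
      have h3 : #(P ∪ R₁ ∪ R₂) = #P + #R₁ + #R₂ := by
        rw [card_union_of_disjoint (disjoint_union_left.2 ⟨hP2, h12⟩), card_union_of_disjoint hP1]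
      rw [← h3]
      simpa using card_le_univ (P ∪ R₁ ∪ R₂)
    omega

/-- Select slots of the first tuple on `H`, and of the second tuple elsewhere. -/
def mixSlots (P H : Finset (Fin q)) (e : (Fin q → V) × (Fin q → V)) : ↥(Pᶜ) → V :=
  fun r => if (r : Fin q) ∈ H then e.1 r else e.2 r

/-- Expand the product over the set `R` of slots where agreement is chosen. Each `R` contributes at
most `(κ ^ 2) ^ #Pᶜ`, and there are at most `2 ^ q` of them. -/
lemma sum_pairWeight_mixSlots_le [Nonempty V] (hκ : 0 < κ) (hτ : τ ≤ κ ^ q) (hκ1 : κ ≤ 1)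
    (hp1 : ∀ i, ∑ C, |p i C| ≤ 1)
    (hp : ∀ i r v, ∑ C, (if C r = v then |p i C| else 0) ≤ τ) (hP : P.Nonempty)
    (hdeg : ∀ C ∈ G, 0 < tupleDegree p P C)
    (hmax : ∀ C ∈ G, ∀ R : Finset (Fin q), R.Nonempty →
      tupleDegree p R C * slotScale q κ #P ≤ tupleDegree p P C * slotScale q κ #R)
    (i : ι) {H : Finset (Fin q)} (h1 : 2 * #(Pᶜ ∩ H) ≤ q) (h2 : 2 * #(Pᶜ \ H) ≤ q)
    (u : ↥(Pᶜ) → V) :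
    ∑ e, pairWeight p G P i e * ∏ r, (κ ^ 2 + if mixSlots P H e r = u r then 1 else 0) ≤
      2 ^ q * (κ ^ 2) ^ Fintype.card ↥(Pᶜ) := by
  obtain ⟨v₀⟩ := ‹Nonempty V›
  set u' : Fin q → V := fun r => if h : r ∈ Pᶜ then u ⟨r, h⟩ else v₀ with hu'
  have hprod : ∀ e : (Fin q → V) × (Fin q → V),
      ∏ r, (κ ^ 2 + if mixSlots P H e r = u r then (1 : ℝ) else 0) =
        ∑ R ∈ (Pᶜ).powerset, (κ ^ 2) ^ (#(Pᶜ) - #R) *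
          (if (∀ r ∈ R ∩ H, e.1 r = u' r) ∧ ∀ r ∈ R \ H, e.2 r = u' r then 1 else 0) := by
    intro e
    have h3 : ∏ r, (κ ^ 2 + if mixSlots P H e r = u r then (1 : ℝ) else 0) =
        ∏ r ∈ Pᶜ, ((if (if r ∈ H then e.1 r else e.2 r) = u' r then (1 : ℝ) else 0) + κ ^ 2) := by
      rw [← prod_coe_sort (Pᶜ)]
      refine prod_congr rfl fun r _ => ?_
      have : u' r = u r := by simp only [hu', dif_pos r.2]
      rw [add_comm, this]
      rfl
    rw [h3, prod_add]
    refine sum_congr rfl fun R hR => ?_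
    rw [prod_const, card_sdiff_of_subset (mem_powerset.1 hR), mul_comm, prod_boole]
    congr 2
    refine propext ⟨fun h => ⟨fun r hr => ?_, fun r hr => ?_⟩, fun h r hr => ?_⟩
    · have := h r (mem_inter.1 hr).1
      rwa [if_pos (mem_inter.1 hr).2] at this
    · have := h r (mem_sdiff.1 hr).1
      rwa [if_neg (mem_sdiff.1 hr).2] at this
    · by_cases hH : r ∈ H
      · rw [if_pos hH]; exact h.1 r (mem_inter.2 ⟨hr, hH⟩)
      · rw [if_neg hH]; exact h.2 r (mem_sdiff.2 ⟨hr, hH⟩)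
  simp_rw [hprod, mul_sum]
  rw [sum_comm]
  have hterm : ∀ R ∈ (Pᶜ).powerset, ∑ e, pairWeight p G P i e * ((κ ^ 2) ^ (#(Pᶜ) - #R) *
      (if (∀ r ∈ R ∩ H, e.1 r = u' r) ∧ ∀ r ∈ R \ H, e.2 r = u' r then 1 else 0)) ≤
      (κ ^ 2) ^ #(Pᶜ) := by
    intro R hR
    have hRP := mem_powerset.1 hR
    have hd : Disjoint P R := disjoint_of_subset_right hRP disjoint_compl_right
    have h3 := sum_pairWeight_agree_le hκ hτ hκ1 hp1 hp hP hdeg hmax i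
      (R₁ := R ∩ H) (R₂ := R \ H)
      (le_trans (Nat.mul_le_mul_left 2 (card_le_card (inter_subset_inter_right hRP))) h1)
      (le_trans (Nat.mul_le_mul_left 2 (card_le_card (sdiff_subset_sdiff hRP le_rfl))) h2)
      (disjoint_sdiff_inter R H).symm (disjoint_of_subset_right inter_subset_left hd)
      (disjoint_of_subset_right sdiff_subset hd) u'
    rw [card_inter_add_card_sdiff, pow_mul] at h3
    calc _ = (κ ^ 2) ^ (#(Pᶜ) - #R) * ∑ e, pairWeight p G P i e *
          (if (∀ r ∈ R ∩ H, e.1 r = u' r) ∧ ∀ r ∈ R \ H, e.2 r = u' r then 1 else 0) := by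
          rw [mul_sum]
          exact sum_congr rfl fun e _ => by ring
      _ ≤ (κ ^ 2) ^ (#(Pᶜ) - #R) * (κ ^ 2) ^ #R := by gcongr
      _ = _ := by rw [← pow_add, Nat.sub_add_cancel (card_le_card hRP)]
  refine (sum_le_card_nsmul _ _ _ hterm).trans ?_
  rw [card_powerset, nsmul_eq_mul, Fintype.card_coe]
  push_cast
  gcongr
  · norm_num
  · simpa using card_le_univ (Pᶜ)

end Degree

/-! ### Cauchy–Schwarz over fibres, and decoupling of signs -/

section Averaging

/-- Cauchy–Schwarz over the fibres of `π`, weighted by their masses `d`; `ha` makes fibres of mass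
zero harmless. -/
lemma sq_sum_le_sum_fiber {T Q : Type*} [Fintype T] [DecidableEq Q] [Fintype Q] (π : T → Q)
    (a μ : T → ℝ) (d : Q → ℝ) (hμ : ∀ C, 0 ≤ μ C) (hd : ∀ Q, d Q = ∑ C, if π C = Q then μ C else 0)
    (ha : ∀ C, d (π C) = 0 → a C = 0) {K : ℝ} (hK : ∑ C, μ C ≤ K) :
    (∑ C, a C) ^ 2 ≤
      K * ∑ C, ∑ C', if π C' = π C then a C * a C' / d (π C) else 0 := by
  set Y : Q → ℝ := fun Q => ∑ C, if π C = Q then a C else 0 with hY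
  have hd0 : ∀ Q, 0 ≤ d Q := fun Q => by
    rw [hd]
    exact sum_nonneg fun C _ => by split_ifs; exacts [hμ C, le_rfl]
  have h1 : ∑ C, a C = ∑ Q, Y Q := by
    simp only [hY]
    rw [sum_comm]
    simp
  have h2 : ∑ C, μ C = ∑ Q, d Q := by
    simp_rw [hd]
    rw [sum_comm]
    simp
  have h3 : ∑ C, ∑ C', (if π C' = π C then a C * a C' / d (π C) else 0) =
      ∑ Q, Y Q ^ 2 / d Q := by
    have : ∀ Q, Y Q ^ 2 / d Q =
        ∑ C, if π C = Q then ∑ C', (if π C' = Q then a C * a C' / d Q else 0) else 0 := by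
      intro Q
      simp only [hY, sq]
      rw [sum_mul, sum_div]
      refine sum_congr rfl fun C _ => ?_
      split_ifs
      · rw [mul_sum, sum_div]
        refine sum_congr rfl fun C' _ => ?_
        split_ifs <;> simp
      · simp
    simp_rw [this]
    symm
    rw [sum_comm]
    exact sum_congr rfl fun C _ => by rw [sum_ite_eq, if_pos (mem_univ _)]
  rw [h2] at hK
  rw [h1, h3]
  refine le_trans ?_ (mul_le_mul_of_nonneg_right hK
    (sum_nonneg fun Q _ => div_nonneg (sq_nonneg (Y Q)) (hd0 Q)))
  refine sum_sq_le_sum_mul_sum_of_sq_le_mul _ (fun Q _ => hd0 Q)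
    (fun Q _ => div_nonneg (sq_nonneg _) (hd0 Q)) fun Q _ => ?_
  rcases (hd0 Q).eq_or_lt with h0 | h0
  · have : Y Q = 0 := sum_eq_zero fun C _ => by
      split_ifs with h
      · exact ha C (by rw [h, ← h0])
      · rfl
    simp [this, ← h0]
  · exact le_of_eq (by field_simp)

variable {ι : Type*} [Fintype ι] [DecidableEq ι]

/-- A uniformly random `s` sends an ordered pair of distinct indices to `(1, -1)` with probability
1/4, and some `s` does at least as well as the average. -/
lemma exists_bipartition (t : ι → ι → ℝ) :
    ∃ s : ι → ℤˣ, ∑ i, ∑ j, (if i ≠ j then t i j else 0) ≤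
      4 * ∑ i, ∑ j, if s i = 1 ∧ s j = -1 then t i j else 0 := by
  have hcount : ∀ i j, ∑ s : ι → ℤˣ, (if s i = 1 ∧ s j = -1 then t i j else 0) * 4 =
      2 ^ Fintype.card ι * if i ≠ j then t i j else 0 := by
    intro i j
    by_cases hij : i = j
    · subst hij
      rw [if_neg (by simp), mul_zero]
      refine sum_eq_zero fun s _ => ?_
      rw [if_neg, zero_mul]
      rintro ⟨h1, h2⟩
      rw [h1] at h2
      exact absurd h2 (by decide)
    · rw [if_pos hij]
      -- Four times the indicator is `(1 + s_i) (1 - s_j)`, a product over coordinates.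
      have h1 : ∀ s : ι → ℤˣ, (if s i = 1 ∧ s j = -1 then t i j else 0) * 4 =
          t i j * ∏ l, ((if l = i then 1 + sgn (s l) else 1) *
            if l = j then 1 - sgn (s l) else 1) := by
        intro s
        rw [prod_mul_distrib, prod_ite_eq' univ i, prod_ite_eq' univ j, if_pos (mem_univ _),
          if_pos (mem_univ _)]
        rcases Int.units_eq_one_or (s i) with hi | hi <;>
          rcases Int.units_eq_one_or (s j) with hj | hj <;>
          (simp [hi, hj, sgn]; try norm_num)
      simp_rw [h1]
      rw [← mul_sum, mul_comm,
        sum_signs_prod fun l u => (if l = i then 1 + sgn u else 1) * if l = j then 1 - sgn u else 1]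
      congr 1
      rw [← card_univ, ← prod_const]
      refine prod_congr rfl fun l _ => ?_
      by_cases hli : l = i
      · have : l ≠ j := fun h => hij (hli.symm.trans h)
        simp [hli, hij, sgn]; norm_num
      · by_cases hlj : l = j
        · simp [hlj, Ne.symm hij, sgn]; norm_num
        · simp [hli, hlj]; norm_num
  have hsum : ∑ s : ι → ℤˣ, 4 * ∑ i, ∑ j, (if s i = 1 ∧ s j = -1 then t i j else 0) =
      ∑ _s : ι → ℤˣ, ∑ i, ∑ j, if i ≠ j then t i j else 0 := by
    rw [sum_const, card_univ, nsmul_eq_mul, card_signs, ← mul_sum, sum_comm, mul_sum, mul_sum]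
    refine sum_congr rfl fun i _ => ?_
    rw [sum_comm, mul_sum, mul_sum]
    refine sum_congr rfl fun j _ => ?_
    rw [← hcount, ← sum_mul, mul_comm]
  obtain ⟨s, -, hs⟩ := exists_le_of_sum_le (univ_nonempty (α := ι → ℤˣ)) hsum.ge
  exact ⟨s, hs⟩

/-- Take the signs from `b` where `s = 1`, and from `b'` elsewhere. -/
def mergeSigns (s b b' : ι → ℤˣ) : ι → ℤˣ := fun i => if s i = 1 then b i else b' i

/-- Exchanging the coordinates with `s i ≠ 1` between `b` and `b'` is an involution of pairs, so the
merged vector is again uniform. -/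
lemma sum_mergeSigns (s : ι → ℤˣ) (F : (ι → ℤˣ) → ℝ) :
    ∑ b' : ι → ℤˣ, ∑ b : ι → ℤˣ, F (mergeSigns s b b') = 2 ^ Fintype.card ι * ∑ b, F b := by
  have hinv : Function.Involutive fun e : (ι → ℤˣ) × (ι → ℤˣ) =>
      (mergeSigns s e.2 e.1, mergeSigns s e.1 e.2) := by
    rintro ⟨b', b⟩
    refine Prod.ext ?_ ?_ <;> funext i <;> by_cases h : s i = 1 <;> simp [mergeSigns, h]
  calc ∑ b' : ι → ℤˣ, ∑ b : ι → ℤˣ, F (mergeSigns s b b')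
      = ∑ e : (ι → ℤˣ) × (ι → ℤˣ), F (hinv.toPerm _ e).1 := by
        rw [Fintype.sum_prod_type]; rfl
    _ = ∑ e : (ι → ℤˣ) × (ι → ℤˣ), F e.1 := Equiv.sum_comp _ fun e : (ι → ℤˣ) × (ι → ℤˣ) => F e.1
    _ = _ := by
        rw [Fintype.sum_prod_type, mul_sum]
        refine sum_congr rfl fun b _ => ?_
        simp only [sum_const, card_univ, nsmul_eq_mul, card_signs]

end Averaging

/-! ### Pairs of tuples across a bipartition of the colours -/

section Pairs

variable {ι V : Type*} [Fintype ι] [DecidableEq ι] [Fintype V] [DecidableEq V] [Nonempty V] {q : ℕ}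

omit [Fintype V] [DecidableEq V] [Nonempty V] in
-- Slots in `P` cancel because the tuples agree there. The two mixtures together use every other
-- slot of each tuple exactly once.
lemma prod_mixSlots {x : V → ℝ} (hx : ∀ v, x v * x v = 1) {P : Finset (Fin q)} (H : Finset (Fin q))
    {e : (Fin q → V) × (Fin q → V)} (he : ∀ r ∈ P, e.2 r = e.1 r) :
    (∏ r, x (mixSlots P H e r)) * ∏ r, x (mixSlots P (Pᶜ \ H) e r) =
      (∏ r, x (e.1 r)) * ∏ r, x (e.2 r) := by
  rw [← prod_mul_distrib, ← prod_mul_distrib, ← prod_mul_prod_compl P]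
  have h1 : ∏ r ∈ P, x (e.1 r) * x (e.2 r) = 1 :=
    prod_eq_one fun r hr => by rw [he r hr, hx]
  rw [h1, one_mul, ← prod_coe_sort (Pᶜ)]
  refine prod_congr rfl fun r _ => ?_
  by_cases h : (r : Fin q) ∈ H
  · simp [mixSlots, h]
  · have hr := r.2
    have h' : (r : Fin q) ∈ Pᶜ \ H := mem_sdiff.2 ⟨hr, h⟩
    rw [mixSlots, mixSlots, if_neg h, if_pos h', mul_comm]

/-- The correlation of the colours `i` and `j` through pairs of tuples agreeing on `P`. -/
noncomputable def pairForm (p : ι → (Fin q → V) → ℝ) (G : Finset (Fin q → V)) (P : Finset (Fin q))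
    (x : V → ℝ) (i j : ι) : ℝ :=
  ∑ e : (Fin q → V) × (Fin q → V), if e.1 ∈ G ∧ e.2 ∈ G ∧ ∀ r ∈ P, e.2 r = e.1 r then
    p i e.1 * p j e.2 / tupleDegree p P e.1 * ((∏ r, x (e.1 r)) * ∏ r, x (e.2 r)) else 0

variable {p : ι → (Fin q → V) → ℝ} {τ κ : ℝ} {G : Finset (Fin q → V)} {P : Finset (Fin q)}

/-- Conditionally on the signs of the colours with `s = -1`, the form is linear in the remaining
signs, so the Kikuchi bound applies. Its degree bound `D` and its density factor share the power `(κ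
^ 2) ^ #Pᶜ`, which cancels. -/
lemma sum_pairForm_bipartite_le {m : ℕ} (hκ : 0 < κ) (hτ : τ ≤ κ ^ q) (hκ1 : κ ≤ 1)
    (hm : κ ^ 2 = m / Fintype.card V)
    (hp1 : ∀ i, ∑ C, |p i C| ≤ 1)
    (hp : ∀ i r v, ∑ C, (if C r = v then |p i C| else 0) ≤ τ) (hP : P.Nonempty)
    (hdeg : ∀ C ∈ G, 0 < tupleDegree p P C)
    (hmax : ∀ C ∈ G, ∀ R : Finset (Fin q), R.Nonempty →
      tupleDegree p R C * slotScale q κ #P ≤ tupleDegree p P C * slotScale q κ #R)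
    (x : (ι → ℤˣ) → V → ℝ) (hx : ∀ b v, x b v * x b v = 1) (s : ι → ℤˣ) :
    ∑ b : ι → ℤˣ, ∑ i, ∑ j,
      (if s i = 1 ∧ s j = -1 then sgn (b i) * sgn (b j) * pairForm p G P (x b) i j else 0) ≤
      2 ^ Fintype.card ι * (8 * 2 ^ q * Real.sqrt (32 * Fintype.card ι *
        (q * m * Real.log (Fintype.card V) + 1))) := by
  have hVpos : 0 < Fintype.card V := Fintype.card_pos
  -- Since `P` is nonempty, `#Pᶜ ≤ q - 1`, so even the larger part of a balanced split of `Pᶜ` has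
  -- at most `q / 2` slots.
  obtain ⟨H, hHP, hH⟩ := exists_subset_card_eq (s := Pᶜ) (n := #(Pᶜ) / 2) (Nat.div_le_self _ _)
  have hcP : #(Pᶜ) + 1 ≤ q := by
    have h1 := card_pos.2 hP
    have h2 := card_compl_add_card P
    rw [Fintype.card_fin] at h2
    omega
  have hcd : #(Pᶜ \ H) = #(Pᶜ) - #H := card_sdiff_of_subset hHP
  have h1 : Pᶜ ∩ H = H := inter_eq_right.2 hHP
  have h2 : Pᶜ ∩ (Pᶜ \ H) = Pᶜ \ H := inter_eq_right.2 sdiff_subset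
  have h3 : Pᶜ \ (Pᶜ \ H) = H := by rw [sdiff_sdiff_right_self, inf_eq_inter, h1]
  set D : ℝ := 2 ^ q * (κ ^ 2) ^ Fintype.card ↥(Pᶜ) with hD
  have hD0 : 0 < D := by positivity
  have hα := fun i u => sum_pairWeight_mixSlots_le hκ hτ hκ1 hp1 hp hP hdeg hmax i
    (H := H) (by rw [h1]; omega) (by omega) u
  have hβ := fun i u => sum_pairWeight_mixSlots_le hκ hτ hκ1 hp1 hp hP hdeg hmax i
    (H := Pᶜ \ H) (by rw [h2]; omega) (by rw [h3]; omega) u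
  -- The frozen signs `b'` are absorbed into the weights, which stay dominated by `pairWeight`
  -- whatever `b'` is.
  set w : (ι → ℤˣ) → ι → (Fin q → V) × (Fin q → V) → ℝ := fun b' i e =>
    if s i = 1 then (if e.1 ∈ G ∧ e.2 ∈ G ∧ ∀ r ∈ P, e.2 r = e.1 r then
      p i e.1 * (∑ j, if s j = -1 then sgn (b' j) * p j e.2 else 0) / tupleDegree p P e.1
      else 0) else 0 with hw
  have hwν : ∀ b' i e, |w b' i e| ≤ pairWeight p G P i e := by
    intro b' i e
    simp only [hw]
    by_cases hs : s i = 1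
    swap
    · rw [if_neg hs, abs_zero]; exact pairWeight_nonneg p G P i e
    rw [if_pos hs, pairWeight]
    split_ifs with hc
    · rw [abs_div, abs_mul, abs_of_pos (hdeg _ hc.1)]
      have := hdeg _ hc.1
      gcongr
      refine (abs_sum_le_sum_abs _ _).trans (sum_le_sum fun j _ => ?_)
      split_ifs
      · rw [abs_mul, abs_sgn, one_mul]
      · rw [abs_zero]; exact abs_nonneg _
    · simp
  set F : (ι → ℤˣ) → ℝ := fun b => ∑ i, ∑ j,
    (if s i = 1 ∧ s j = -1 then sgn (b i) * sgn (b j) * pairForm p G P (x b) i j else 0) with hF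
  have hmerge : ∀ b b', F (mergeSigns s b b') = ∑ i, sgn (b i) * ∑ e, w b' i e *
      ((∏ r, x (mergeSigns s b b') (mixSlots P H e r)) *
        ∏ r, x (mergeSigns s b b') (mixSlots P (Pᶜ \ H) e r)) := by
    intro b b'
    refine sum_congr rfl fun i _ => ?_
    by_cases hs : s i = 1
    swap
    · simp [hw, hs]
    simp only [hw, hs, true_and, if_true]
    have hbi : mergeSigns s b b' i = b i := by simp [mergeSigns, hs]
    rw [mul_sum]
    calc _ = ∑ j, ∑ e : (Fin q → V) × (Fin q → V),
          (if e.1 ∈ G ∧ e.2 ∈ G ∧ ∀ r ∈ P, e.2 r = e.1 r then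
          sgn (b i) * (p i e.1 * (if s j = -1 then sgn (b' j) * p j e.2 else 0) /
            tupleDegree p P e.1 * ((∏ r, x (mergeSigns s b b') (e.1 r)) *
              ∏ r, x (mergeSigns s b b') (e.2 r))) else 0) := by
          refine sum_congr rfl fun j _ => ?_
          by_cases hj : s j = -1
          · have hbj : mergeSigns s b b' j = b' j := by
              rw [mergeSigns, hj, if_neg (by decide)]
            rw [if_pos hj, hbi, hbj, pairForm, mul_sum]
            refine sum_congr rfl fun e _ => ?_
            split_ifs
            · ring
            · rw [mul_zero]
          · rw [if_neg hj]
            refine (sum_eq_zero fun e _ => ?_).symm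
            split_ifs
            · simp
            · rfl
      _ = _ := by
          rw [sum_comm]
          refine sum_congr rfl fun e _ => ?_
          by_cases hc : e.1 ∈ G ∧ e.2 ∈ G ∧ ∀ r ∈ P, e.2 r = e.1 r
          · simp only [if_pos hc]
            rw [prod_mixSlots (hx _) H hc.2.2, mul_sum, sum_div, sum_mul, mul_sum]
          · simp [if_neg hc]
  set B : ℝ := 8 * 2 ^ q * Real.sqrt (32 * Fintype.card ι *
        (q * m * Real.log (Fintype.card V) + 1)) with hB
  have hfix : ∀ b', ∑ b, F (mergeSigns s b b') ≤ 2 ^ Fintype.card ι * B := by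
    intro b'
    have h := sum_signed_monomials_le (m := m) (hwν b') hD0
      (fun i u => by rw [← hm]; exact hα i u) (fun i u => by rw [← hm]; exact hβ i u)
      (fun b => x (mergeSigns s b b')) (fun b v => hx _ v)
    simp_rw [← hmerge] at h
    rw [← hm] at h
    have hpos : 0 < (κ ^ 2) ^ Fintype.card ↥(Pᶜ) := by positivity
    refine le_of_mul_le_mul_left (h.trans ?_) hpos
    have hlog : 0 ≤ Real.log (Fintype.card V) := Real.log_natCast_nonneg _
    have hA : (Fintype.card ↥(Pᶜ) : ℝ) ≤ q := by
      rw [Fintype.card_coe]; exact_mod_cast (by omega : #(Pᶜ) ≤ q)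
    calc _ ≤ 2 ^ Fintype.card ι * (8 * D * Real.sqrt (32 * Fintype.card ι *
          (q * m * Real.log (Fintype.card V) + 1))) := by gcongr
      _ = _ := by rw [hD, hB]; ring
  have htot : ∑ b' : ι → ℤˣ, ∑ b, F (mergeSigns s b b') ≤
      2 ^ Fintype.card ι * (2 ^ Fintype.card ι * B) := by
    refine (sum_le_card_nsmul _ _ _ fun b' _ => hfix b').trans ?_
    rw [card_univ, nsmul_eq_mul, card_signs]
  rw [sum_mergeSigns] at htot
  exact le_of_mul_le_mul_left htot (by positivity)

end Pairs

/-! ### Upper bound for smooth systems correlated with random signs -/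

section Core

variable {ι V : Type*} [Fintype ι] [Fintype V] [DecidableEq V] {q : ℕ}

lemma exists_max_slotSet (p : ι → (Fin q → V) → ℝ) {κ : ℝ} (hκ : 0 < κ) (r₀ : Fin q)
    (C : Fin q → V) :
    ∃ P : Finset (Fin q), P.Nonempty ∧ ∀ R : Finset (Fin q), R.Nonempty →
      tupleDegree p R C * slotScale q κ #P ≤ tupleDegree p P C * slotScale q κ #R := by
  obtain ⟨P, hP, hmax⟩ := exists_max_image ({P | P.Nonempty} : Finset (Finset (Fin q)))
    (fun P => tupleDegree p P C / slotScale q κ #P) ⟨{r₀}, by simp⟩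
  refine ⟨P, by simpa using hP, fun R hR => ?_⟩
  have h := hmax R (by simpa using hR)
  rwa [div_le_div_iff₀ (slotScale_pos hκ _ _) (slotScale_pos hκ _ _)] at h

/-- All tuples with a given value in slot `r₀` share one degree, so each value contributes at most
`c`. -/
lemma sum_low_degree_le (p : ι → (Fin q → V) → ℝ) (r₀ : Fin q) {c : ℝ} (hc : 0 ≤ c) :
    ∑ C, (if tupleDegree p {r₀} C < c then ∑ i, |p i C| else 0) ≤ Fintype.card V * c := by
  have h1 : ∑ C, (if tupleDegree p {r₀} C < c then ∑ i, |p i C| else 0) =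
      ∑ v, ∑ C, if C r₀ = v then
        (if tupleDegree p {r₀} C < c then ∑ i, |p i C| else 0) else 0 := by
    rw [sum_comm]
    exact sum_congr rfl fun C _ => by rw [sum_ite_eq, if_pos (mem_univ _)]
  rw [h1, ← nsmul_eq_mul, ← card_univ]
  refine sum_le_card_nsmul _ _ _ fun v _ => ?_
  by_cases hv : ∃ C, C r₀ = v ∧ tupleDegree p {r₀} C < c
  · obtain ⟨C₀, hC₀, hlt⟩ := hv
    refine le_trans (sum_le_sum fun C _ => ?_) hlt.le
    have : (∀ r ∈ ({r₀} : Finset (Fin q)), C r = C₀ r) ↔ C r₀ = v := by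
      rw [← hC₀]; simp
    simp only [this]
    split_ifs
    exacts [le_rfl, sum_abs_nonneg p C, le_rfl]
  · refine le_trans (le_of_eq (sum_eq_zero fun C _ => ?_)) hc
    split_ifs with h h'
    exacts [absurd ⟨C, h, h'⟩ hv, rfl, rfl]

omit [Fintype V] [DecidableEq V] in
lemma abs_prod_eq_one {J : Type*} [Fintype J] {x : V → ℝ} (hx : ∀ v, x v * x v = 1) (C : J → V) :
    |∏ r, x (C r)| = 1 := by
  rw [abs_prod]
  refine prod_eq_one fun r _ => ?_
  rcases mul_self_eq_one_iff.1 (hx (C r)) with h | h <;> simp [h]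

variable {p : ι → (Fin q → V) → ℝ} {τ : ℝ} {G : Finset (Fin q → V)} {P : Finset (Fin q)}

/-- Within a single colour, smoothness bounds the mass of second tuples matching on `P` by `τ`,
while the denominators are at least `c`. -/
lemma pairForm_self_le (hp1 : ∀ i, ∑ C, |p i C| ≤ 1)
    (hp : ∀ i r v, ∑ C, (if C r = v then |p i C| else 0) ≤ τ) (hτ : 0 ≤ τ) (hP : P.Nonempty)
    {c : ℝ} (hc : 0 < c) (hdeg : ∀ C ∈ G, c ≤ tupleDegree p P C)
    {x : V → ℝ} (hx : ∀ v, x v * x v = 1) (i : ι) : pairForm p G P x i i ≤ τ / c := by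
  rw [pairForm, Fintype.sum_prod_type]
  calc _ ≤ ∑ C, |p i C| / c * ∑ C', (if ∀ r ∈ P, C' r = C r then |p i C'| else 0) := by
        refine sum_le_sum fun C _ => ?_
        rw [mul_sum]
        refine sum_le_sum fun C' _ => ?_
        have hn : 0 ≤ |p i C| / c * (if ∀ r ∈ P, C' r = C r then |p i C'| else 0) := by
          refine mul_nonneg (by positivity) ?_
          split_ifs
          exacts [abs_nonneg _, le_rfl]
        by_cases h : C ∈ G ∧ C' ∈ G ∧ ∀ r ∈ P, C' r = C r
        · simp only [if_pos h, if_pos h.2.2]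
          refine (le_abs_self _).trans ?_
          have hd := hdeg C h.1
          rw [abs_mul, abs_mul, abs_prod_eq_one hx, abs_prod_eq_one hx, mul_one, mul_one, abs_div,
            abs_mul, abs_of_pos (hc.trans_le hd), div_mul_eq_mul_div]
          gcongr
        · rw [if_neg h]; exact hn
    _ ≤ ∑ C, |p i C| / c * τ := by
        refine sum_le_sum fun C _ => ?_
        exact mul_le_mul_of_nonneg_left (sum_agree_le (fun _ => abs_nonneg _) (hp i) hP C)
          (by positivity)
    _ = (∑ C, |p i C|) * (τ / c) := by
        rw [sum_mul]
        exact sum_congr rfl fun C _ => by ring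
    _ ≤ 1 * (τ / c) := mul_le_mul_of_nonneg_right (hp1 i) (by positivity)
    _ = _ := one_mul _

/-- Cauchy–Schwarz over the fibres of restriction to `P`; the total mass is at most one per colour.
-/
lemma sq_sum_le_sum_pairForm (hp1 : ∀ i, ∑ C, |p i C| ≤ 1)
    (hdeg : ∀ C ∈ G, 0 < tupleDegree p P C) (x : V → ℝ) (b : ι → ℤˣ) :
    (∑ i, sgn (b i) * ∑ C, if C ∈ G then p i C * ∏ r, x (C r) else 0) ^ 2 ≤
      Fintype.card ι * ∑ i, ∑ j, sgn (b i) * sgn (b j) * pairForm p G P x i j := by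
  set a : (Fin q → V) → ℝ := fun C =>
    if C ∈ G then (∑ i, sgn (b i) * p i C) * ∏ r, x (C r) else 0 with ha
  set π : (Fin q → V) → (↥P → V) := fun C r => C r with hπ
  have hπ' : ∀ C C', π C' = π C ↔ ∀ r ∈ P, C' r = C r := fun C C' => by
    simp [hπ, funext_iff]
  set d : (↥P → V) → ℝ := fun Q => ∑ C, if π C = Q then ∑ i, |p i C| else 0 with hd
  have hdπ : ∀ C, d (π C) = tupleDegree p P C := fun C => by
    simp only [hd, tupleDegree, hπ']
  have hK : ∑ C, ∑ i, |p i C| ≤ Fintype.card ι := by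
    rw [sum_comm]
    refine (sum_le_card_nsmul _ _ 1 fun i _ => hp1 i).trans ?_
    simp
  have h := sq_sum_le_sum_fiber π a (fun C => ∑ i, |p i C|) d (fun C => sum_abs_nonneg p C)
    (fun _ => rfl) (fun C h0 => by
      rw [hdπ] at h0
      simp only [ha]
      exact if_neg fun hC => (hdeg C hC).ne' h0) hK
  have hX : ∑ i, sgn (b i) * ∑ C, (if C ∈ G then p i C * ∏ r, x (C r) else 0) = ∑ C, a C := by
    simp_rw [mul_sum]
    rw [sum_comm]
    refine sum_congr rfl fun C _ => ?_
    simp only [ha]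
    split_ifs
    · rw [sum_mul]
      exact sum_congr rfl fun i _ => by ring
    · simp
  rw [hX]
  refine h.trans (le_of_eq ?_)
  congr 1
  have hW : ∑ i, ∑ j, sgn (b i) * sgn (b j) * pairForm p G P x i j =
      ∑ e : (Fin q → V) × (Fin q → V), ∑ i, ∑ j, sgn (b i) * sgn (b j) *
        if e.1 ∈ G ∧ e.2 ∈ G ∧ ∀ r ∈ P, e.2 r = e.1 r then
          p i e.1 * p j e.2 / tupleDegree p P e.1 * ((∏ r, x (e.1 r)) * ∏ r, x (e.2 r)) else 0 := by
    simp_rw [pairForm, mul_sum]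
    symm
    rw [sum_comm]
    refine sum_congr rfl fun i _ => ?_
    rw [sum_comm]
  rw [hW, Fintype.sum_prod_type]
  refine sum_congr rfl fun C _ => sum_congr rfl fun C' _ => ?_
  simp only [hπ', hdπ, ha]
  by_cases hc : C ∈ G ∧ C' ∈ G ∧ ∀ r ∈ P, C' r = C r
  · simp only [if_pos hc, if_pos hc.1, if_pos hc.2.1, if_pos hc.2.2]
    rw [mul_mul_mul_comm, sum_mul_sum, sum_mul, sum_div]
    refine sum_congr rfl fun i _ => ?_
    rw [sum_mul, sum_div]
    exact sum_congr rfl fun j _ => by ring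
  · simp only [if_neg hc, mul_zero, sum_const_zero]
    by_cases h1 : C ∈ G
    · by_cases h2 : C' ∈ G
      · rw [if_neg fun h3 => hc ⟨h1, h2, h3⟩]
      · simp [h2]
    · simp [h1]

variable {κ : ℝ}

/-- Tuples of low degree at `r₀` carry at most half of the signal. The others are sorted by a
maximising slot set, and one of the `2 ^ q` classes keeps its share. -/
lemma exists_heavy_class [DecidableEq ι] (hκ : 0 < κ) (r₀ : Fin q)
    (x : (ι → ℤˣ) → V → ℝ) (hx : ∀ b v, x b v * x b v = 1) {η c : ℝ} (hη : 0 < η)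
    (hc : 0 ≤ c) (hι : 0 < Fintype.card ι)
    (hcη : 2 * (Fintype.card V * c) ≤ η * Fintype.card ι)
    (hsig : 2 ^ Fintype.card ι * (η * Fintype.card ι) ≤
      ∑ b : ι → ℤˣ, ∑ i, sgn (b i) * ∑ C, p i C * ∏ r, x b (C r)) :
    ∃ (P : Finset (Fin q)) (G : Finset (Fin q → V)), P.Nonempty ∧
      (∀ C ∈ G, c ≤ tupleDegree p {r₀} C) ∧
      (∀ C ∈ G, ∀ R : Finset (Fin q), R.Nonempty →
        tupleDegree p R C * slotScale q κ #P ≤ tupleDegree p P C * slotScale q κ #R) ∧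
      2 ^ Fintype.card ι * (η / 2 ^ (q + 1) * Fintype.card ι) ≤
        ∑ b : ι → ℤˣ, ∑ i, sgn (b i) * ∑ C, if C ∈ G then p i C * ∏ r, x b (C r) else 0 := by
  choose Pm hPm hmax using exists_max_slotSet p hκ r₀
  set G : Finset (Fin q) → Finset (Fin q → V) := fun P =>
    {C | Pm C = P ∧ ¬ tupleDegree p {r₀} C < c} with hG
  have hmem : ∀ P C, C ∈ G P ↔ Pm C = P ∧ ¬ tupleDegree p {r₀} C < c := fun P C => by simp [hG]
  set S : Finset (Fin q) → ℝ := fun P =>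
    ∑ b : ι → ℤˣ, ∑ i, sgn (b i) * ∑ C, if C ∈ G P then p i C * ∏ r, x b (C r) else 0 with hS
  have hsplit : ∀ b : ι → ℤˣ, ∑ i, sgn (b i) * ∑ C, p i C * ∏ r, x b (C r) ≤
      (∑ P, ∑ i, sgn (b i) * ∑ C, if C ∈ G P then p i C * ∏ r, x b (C r) else 0) +
        Fintype.card V * c := by
    intro b
    have h1 : ∑ i, sgn (b i) * ∑ C, p i C * ∏ r, x b (C r) =
        (∑ P, ∑ i, sgn (b i) * ∑ C, if C ∈ G P then p i C * ∏ r, x b (C r) else 0) +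
        ∑ i, ∑ C, if tupleDegree p {r₀} C < c then sgn (b i) * (p i C * ∏ r, x b (C r)) else 0 := by
      rw [sum_comm, ← sum_add_distrib]
      refine sum_congr rfl fun i _ => ?_
      rw [← mul_sum, sum_comm, mul_sum, mul_sum, ← sum_add_distrib]
      refine sum_congr rfl fun C _ => ?_
      simp only [hmem, ite_and]
      rw [sum_ite_eq, if_pos (mem_univ _)]
      split_ifs <;> simp
    rw [h1]
    refine add_le_add le_rfl ?_
    rw [sum_comm]
    refine le_trans (sum_le_sum fun C _ => ?_) (sum_low_degree_le p r₀ hc)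
    split_ifs
    · refine sum_le_sum fun i _ => (le_abs_self _).trans ?_
      rw [abs_mul, abs_mul, abs_sgn, abs_prod_eq_one (hx b), one_mul, mul_one]
    · simp
  have htot : 2 ^ Fintype.card ι * (η * Fintype.card ι) ≤
      (∑ P, S P) + 2 ^ Fintype.card ι * (Fintype.card V * c) := by
    refine hsig.trans ((sum_le_sum fun b _ => hsplit b).trans (le_of_eq ?_))
    rw [sum_add_distrib, sum_const, card_univ, nsmul_eq_mul, card_signs, sum_comm]
  have hk : (0 : ℝ) < Fintype.card ι := by exact_mod_cast hι
  have hpow : (0 : ℝ) < 2 ^ Fintype.card ι := by positivity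
  have hP : ∃ P ∈ (univ : Finset (Finset (Fin q))),
      2 ^ Fintype.card ι * (η / 2 ^ (q + 1) * Fintype.card ι) ≤ S P := by
    refine exists_le_of_sum_le univ_nonempty ?_
    rw [sum_const, card_univ, Fintype.card_finset, Fintype.card_fin, nsmul_eq_mul]
    have h1 : ((2 ^ q : ℕ) : ℝ) * (2 ^ Fintype.card ι * (η / 2 ^ (q + 1) * Fintype.card ι)) =
        2 ^ Fintype.card ι * (η * Fintype.card ι / 2) := by
      push_cast
      rw [pow_succ]
      field_simp
    rw [h1]
    have h2 : (2 : ℝ) ^ Fintype.card ι * (Fintype.card V * c) ≤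
        2 ^ Fintype.card ι * (η * Fintype.card ι / 2) := by
      gcongr; linarith
    have h3 : (2 : ℝ) ^ Fintype.card ι * (η * Fintype.card ι) =
        2 * (2 ^ Fintype.card ι * (η * Fintype.card ι / 2)) := by ring
    linarith
  obtain ⟨P, -, hP⟩ := hP
  -- The pigeonhole ranged over all slot sets, including the empty one; a tuple in the class
  -- certifies that `P` is nonempty.
  have hne : (G P).Nonempty := by
    by_contra hempty
    rw [not_nonempty_iff_eq_empty] at hempty
    have h0 : S P = 0 := by simp [hS, hempty]
    have : 0 < 2 ^ Fintype.card ι * (η / 2 ^ (q + 1) * Fintype.card ι) := by positivity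
    linarith
  obtain ⟨C₀, hC₀⟩ := hne
  refine ⟨P, G P, ?_, fun C hC => not_lt.1 ((hmem P C).1 hC).2, fun C hC R hR => ?_, hP⟩
  · rw [← ((hmem P C₀).1 hC₀).1]; exact hPm C₀
  · have h := hmax C R hR
    rwa [((hmem P C).1 hC).1] at h

/-- A lower bound on the density needed by a system of `card ι` smooth weighted `q`-tuples which
correlate with independent random signs. -/
theorem smooth_system_bound [DecidableEq ι] [Nonempty V] (hq : 2 ≤ q) {m : ℕ} (hκ : 0 < κ)
    (hκ1 : κ ≤ 1) (hm : κ ^ 2 = m / Fintype.card V)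
    (hp1 : ∀ i, ∑ C, |p i C| ≤ 1)
    (hp : ∀ i r v, ∑ C, (if C r = v then |p i C| else 0) ≤ τ) (hτ : 0 ≤ τ)
    (x : (ι → ℤˣ) → V → ℝ) (hx : ∀ b v, x b v * x b v = 1) {η : ℝ} (hη : 0 < η) (hη1 : η ≤ 1)
    (hι : 0 < Fintype.card ι) (hmι : m ≤ Fintype.card ι)
    (hτκ : 16 * 4 ^ q * τ ≤ η ^ 3 * κ ^ q)
    (hsig : 2 ^ Fintype.card ι * (η * Fintype.card ι) ≤
      ∑ b : ι → ℤˣ, ∑ i, sgn (b i) * ∑ C, p i C * ∏ r, x b (C r)) :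
    (η / 2 ^ (q + 1)) ^ 2 * Fintype.card ι / 8 ≤
      8 * 2 ^ q * Real.sqrt (32 * Fintype.card ι * (q * m * Real.log (Fintype.card V) + 1)) := by
  have hV : (0 : ℝ) < Fintype.card V := by exact_mod_cast Fintype.card_pos
  have hk : (0 : ℝ) < Fintype.card ι := by exact_mod_cast hι
  set n : ℝ := ((Fintype.card V : ℕ) : ℝ) with hn
  set k : ℝ := ((Fintype.card ι : ℕ) : ℝ) with hkdef
  set r₀ : Fin q := ⟨0, by omega⟩
  have hτκ' : τ ≤ κ ^ q := by
    have h4 : (1 : ℝ) ≤ 4 ^ q := one_le_pow₀ (by norm_num)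
    have h1 : η ^ 3 * κ ^ q ≤ 1 * κ ^ q := by
      gcongr; exact pow_le_one₀ hη.le hη1
    nlinarith
  obtain ⟨P, G, hP, hlow, hmax, hsigG⟩ := exists_heavy_class (p := p) hκ r₀ x hx hη
    (c := η * k / (2 * n)) (by positivity) hι (by rw [← hn, ← hkdef]; field_simp; rfl) hsig
  rw [← hkdef] at hsigG
  have hκq : 0 < κ ^ q := by positivity
  -- Maximality against `{r₀}` transfers the lower bound on its degree to `P`. Since `m ≤ k`, that
  -- bound is at least `η / 2 * κ ^ 2`.
  have hdeg : ∀ C ∈ G, η / 2 * κ ^ q ≤ tupleDegree p P C := by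
    intro C hC
    have h1 := hmax C hC {r₀} (singleton_nonempty _)
    have h2 := hlow C hC
    rw [card_singleton, slotScale.eq_def q κ 1, mul_one, min_eq_left hq] at h1
    have h3 : κ ^ q ≤ slotScale q κ #P := pow_le_pow_of_le_one hκ.le hκ1 (min_le_right _ _)
    have h4 : η / 2 * κ ^ 2 ≤ tupleDegree p {r₀} C := by
      refine le_trans ?_ h2
      have : (m : ℝ) ≤ k := by rw [hkdef]; exact_mod_cast hmι
      rw [hm, ← mul_div_assoc, div_le_div_iff₀ hV (by positivity)]
      have h5 : η * n * m ≤ η * n * k := by gcongr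
      linarith
    have h6 : (η / 2 * κ ^ q) * κ ^ 2 ≤ tupleDegree p P C * κ ^ 2 := by
      calc (η / 2 * κ ^ q) * κ ^ 2 = (η / 2 * κ ^ 2) * κ ^ q := by ring
        _ ≤ tupleDegree p {r₀} C * slotScale q κ #P :=
          mul_le_mul h4 h3 hκq.le (tupleDegree_nonneg p _ _)
        _ ≤ _ := h1
    exact le_of_mul_le_mul_right h6 (by positivity)
  have hc0 : 0 < η / 2 * κ ^ q := by positivity
  have hdeg0 : ∀ C ∈ G, 0 < tupleDegree p P C := fun C hC => hc0.trans_le (hdeg C hC)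
  set σ : ℝ := η / 2 ^ (q + 1) with hσ
  have hσ0 : 0 < σ := by positivity
  set N : ℝ := 2 ^ Fintype.card ι with hN
  have hN0 : 0 < N := by positivity
  set X : (ι → ℤˣ) → ℝ := fun b =>
    ∑ i, sgn (b i) * ∑ C, if C ∈ G then p i C * ∏ r, x b (C r) else 0 with hX
  set W : (ι → ℤˣ) → ℝ := fun b =>
    ∑ i, ∑ j, sgn (b i) * sgn (b j) * pairForm p G P (x b) i j with hW
  have hXW : ∀ b, X b ^ 2 ≤ k * W b := fun b => sq_sum_le_sum_pairForm hp1 hdeg0 (x b) b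
  have hWsum : N * (σ ^ 2 * k) ≤ ∑ b, W b := by
    have h1 : (∑ b, X b) ^ 2 ≤ N * ∑ b, X b ^ 2 := by
      have := sq_sum_le_card_mul_sum_sq (s := (univ : Finset (ι → ℤˣ))) (f := X)
      rwa [card_univ, card_signs] at this
    have h2 : (N * (σ * k)) ^ 2 ≤ (∑ b, X b) ^ 2 :=
      pow_le_pow_left₀ (by positivity) hsigG 2
    have h3 : ∑ b, X b ^ 2 ≤ k * ∑ b, W b := by
      rw [mul_sum]; exact sum_le_sum fun b _ => hXW b
    have h4 : (N * k) * (N * (σ ^ 2 * k)) ≤ (N * k) * ∑ b, W b := by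
      calc (N * k) * (N * (σ ^ 2 * k)) = (N * (σ * k)) ^ 2 := by ring
        _ ≤ N * ∑ b, X b ^ 2 := h2.trans h1
        _ ≤ N * (k * ∑ b, W b) := by gcongr
        _ = _ := by ring
    exact le_of_mul_le_mul_left h4 (by positivity)
  have hdiag : ∀ b : ι → ℤˣ, W b ≤
      (∑ i, ∑ j, if i ≠ j then sgn (b i) * sgn (b j) * pairForm p G P (x b) i j else 0) +
        σ ^ 2 * k / 2 := by
    intro b
    have h1 : W b =
        (∑ i, ∑ j, if i ≠ j then sgn (b i) * sgn (b j) * pairForm p G P (x b) i j else 0) +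
          ∑ i, pairForm p G P (x b) i i := by
      rw [hW, ← sum_add_distrib]
      refine sum_congr rfl fun i _ => ?_
      have : pairForm p G P (x b) i i =
          ∑ j, if i = j then sgn (b i) * sgn (b j) * pairForm p G P (x b) i j else 0 := by
        rw [sum_ite_eq, if_pos (mem_univ _), sgn_mul_self, one_mul]
      rw [this, ← sum_add_distrib]
      refine sum_congr rfl fun j _ => ?_
      by_cases hij : i = j <;> simp [hij]
    rw [h1]
    refine add_le_add le_rfl ?_
    -- This fixes the constant in `hτκ`: the diagonal may use at most half of the quadratic signal
    -- `σ ^ 2 * k`.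
    have h2 : τ / (η / 2 * κ ^ q) ≤ σ ^ 2 / 2 := by
      rw [div_le_div_iff₀ hc0 (by norm_num), hσ, div_pow, div_mul_eq_mul_div,
        le_div_iff₀ (by positivity)]
      have h4 : ((2 : ℝ) ^ (q + 1)) ^ 2 = 4 * 4 ^ q := by
        rw [← pow_mul, mul_comm, pow_mul, pow_succ]; norm_num; ring
      rw [h4]
      linarith
    refine (sum_le_card_nsmul _ _ (σ ^ 2 / 2) fun i _ =>
      (pairForm_self_le hp1 hp hτ hP hc0 hdeg (hx b) i).trans h2).trans (le_of_eq ?_)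
    rw [card_univ, nsmul_eq_mul, ← hkdef]; ring
  -- The bipartition costs a factor 4; with the half lost to the diagonal this is the 8 in the
  -- conclusion.
  obtain ⟨s, hs⟩ := exists_bipartition fun i j =>
    ∑ b : ι → ℤˣ, sgn (b i) * sgn (b j) * pairForm p G P (x b) i j
  have hbip := sum_pairForm_bipartite_le (p := p) hκ hτκ' hκ1 hm hp1 hp hP hdeg0 hmax x hx s
  rw [← hN, ← hn, ← hkdef] at hbip
  set B : ℝ := 8 * 2 ^ q * Real.sqrt (32 * k * (q * m * Real.log n + 1)) with hB
  have hL : ∑ i, ∑ j, (if i ≠ j then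
      ∑ b : ι → ℤˣ, sgn (b i) * sgn (b j) * pairForm p G P (x b) i j else 0) =
      ∑ b : ι → ℤˣ, ∑ i, ∑ j,
        if i ≠ j then sgn (b i) * sgn (b j) * pairForm p G P (x b) i j else 0 := by
    rw [sum_comm (γ := ι → ℤˣ)]
    refine sum_congr rfl fun i _ => ?_
    rw [sum_comm (γ := ι → ℤˣ)]
    refine sum_congr rfl fun j _ => ?_
    split_ifs <;> simp
  have hR : ∑ i, ∑ j, (if s i = 1 ∧ s j = -1 then
      ∑ b : ι → ℤˣ, sgn (b i) * sgn (b j) * pairForm p G P (x b) i j else 0) =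
      ∑ b : ι → ℤˣ, ∑ i, ∑ j,
        if s i = 1 ∧ s j = -1 then sgn (b i) * sgn (b j) * pairForm p G P (x b) i j else 0 := by
    rw [sum_comm (γ := ι → ℤˣ)]
    refine sum_congr rfl fun i _ => ?_
    rw [sum_comm (γ := ι → ℤˣ)]
    refine sum_congr rfl fun j _ => ?_
    split_ifs <;> simp
  rw [hL, hR] at hs
  have hW2 : ∑ b, W b ≤ (∑ b : ι → ℤˣ, ∑ i, ∑ j,
      if i ≠ j then sgn (b i) * sgn (b j) * pairForm p G P (x b) i j else 0) +
        N * (σ ^ 2 * k / 2) := by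
    refine (sum_le_sum fun b _ => hdiag b).trans (le_of_eq ?_)
    rw [sum_add_distrib, sum_const, card_univ, nsmul_eq_mul, card_signs]
  have hfin : N * (σ ^ 2 * k / 8) ≤ N * B := by linarith
  exact le_of_mul_le_mul_left hfin hN0

end Core

/-! ### A bound that needs no smoothness -/

section TrivialBound

/-- Take `m = |V|`: at density 1 every degree is trivially at most `2 ^ q`. The second half of each
monomial is the constant `v₀`, where `x` is 1. -/
lemma sum_signed_tuples_le {ι V : Type*} [Fintype ι] [DecidableEq ι] [Fintype V] [DecidableEq V]
    {q : ℕ} {p : ι → (Fin q → V) → ℝ} (hp1 : ∀ i, ∑ C, |p i C| ≤ 1) (x : (ι → ℤˣ) → V → ℝ)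
    (hx : ∀ b v, x b v * x b v = 1) (v₀ : V) (hv₀ : ∀ b, x b v₀ = 1) :
    ∑ b : ι → ℤˣ, ∑ i, sgn (b i) * ∑ C, p i C * ∏ r, x b (C r) ≤
      2 ^ Fintype.card ι * (8 * 2 ^ q * Real.sqrt (32 * Fintype.card ι *
        (q * Fintype.card V * Real.log (Fintype.card V) + 1))) := by
  have : Nonempty V := ⟨v₀⟩
  have hV : (Fintype.card V : ℝ) ≠ 0 := by exact_mod_cast Fintype.card_ne_zero
  have hD : ∀ (γ : (Fin q → V) → Fin q → V) (i : ι) (u : Fin q → V),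
      ∑ C, |p i C| * ∏ r, (((Fintype.card V : ℕ) : ℝ) / Fintype.card V +
        if γ C r = u r then 1 else 0) ≤ 2 ^ q := by
    intro γ i u
    calc _ ≤ ∑ C, |p i C| * 2 ^ q := by
          refine sum_le_sum fun C _ => mul_le_mul_of_nonneg_left ?_ (abs_nonneg _)
          rw [div_self hV]
          calc _ ≤ ∏ _r : Fin q, (2 : ℝ) := by
                refine prod_le_prod (fun r _ => ?_) fun r _ => ?_ <;> split_ifs <;> norm_num
            _ = 2 ^ q := by simp
      _ ≤ 1 * 2 ^ q := by
          rw [← sum_mul]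
          exact mul_le_mul_of_nonneg_right (hp1 i) (by positivity)
      _ = _ := one_mul _
  have h := sum_signed_monomials_le (A := Fin q) (m := Fintype.card V) (w := p)
    (ν := fun i C => |p i C|) (fun _ _ => le_rfl) (α := fun C => C) (β := fun _ _ => v₀)
    (D := 2 ^ q) (by positivity) (fun i u => hD _ i u) (fun i u => hD _ i u) x hx
  simpa [div_self hV, hv₀] using h

end TrivialBound

/-! ### From local decoders to smooth systems -/

section Decoder

variable {n q : ℕ}

/-- Evaluate a possibly empty query as the queried sign, or `1`. -/
def querySign (y : Fin n → ℤˣ) (o : Option (Fin n)) : ℝ := o.elim 1 fun v => sgn (y v)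

lemma querySign_none (y : Fin n → ℤˣ) : querySign y none = 1 := rfl

lemma querySign_some (y : Fin n → ℤˣ) (v : Fin n) : querySign y (some v) = sgn (y v) := rfl

lemma exists_fourier_coeff_of_output (q : ℕ) (a : ℤˣ) :
    ∃ c : (Fin q → Option (Fin n)) → ℝ, ∑ C, |c C| ≤ 2 ^ q ∧
      ∀ y : Fin n → ℤˣ, sgn a = ∑ C, c C * ∏ r, querySign y (C r) := by
  refine ⟨fun C => if C = fun _ => none then sgn a else 0, ?_, fun y => ?_⟩
  · have : ∀ C : Fin q → Option (Fin n),
        |if C = (fun _ => none) then sgn a else 0| = if C = (fun _ => none) then 1 else 0 := by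
      intro C; split_ifs <;> simp [abs_sgn]
    simp_rw [this]
    rw [sum_ite_eq', if_pos (mem_univ _)]
    exact one_le_pow₀ (by norm_num)
  · simp_rw [ite_mul, zero_mul]
    rw [sum_ite_eq', if_pos (mem_univ _)]
    simp [querySign]

lemma sum_fin_succ_option (F : (Fin (q + 1) → Option (Fin n)) → ℝ) :
    ∑ C, F C = ∑ C : Fin q → Option (Fin n), F (Fin.cons none C) +
      ∑ v, ∑ C : Fin q → Option (Fin n), F (Fin.cons (some v) C) := by
  rw [← (Fin.consEquiv fun _ : Fin (q + 1) => Option (Fin n)).sum_comp, Fintype.sum_prod_type,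
    Fintype.sum_option]
  rfl

/-- The output of an algorithm which makes at most `q` queries is a polynomial of degree at most
`q` in the queried signs, with coefficients of absolute sum at most `2 ^ q`. -/
lemma exists_fourier_coeff (q : ℕ) (A : OracleAlg n) (Y : Set (Fin n → ℤˣ))
    (hA : ∀ y ∈ Y, A.numQueries y ≤ q) :
    ∃ c : (Fin q → Option (Fin n)) → ℝ, ∑ C, |c C| ≤ 2 ^ q ∧
      ∀ y ∈ Y, sgn (A.run y) = ∑ C, c C * ∏ r, querySign y (C r) := by
  induction A generalizing q Y with
  | output a =>
    obtain ⟨c, h1, h2⟩ := exists_fourier_coeff_of_output (n := n) q a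
    exact ⟨c, h1, fun y _ => h2 y⟩
  | query v next ih =>
    cases q with
    | zero =>
      exact ⟨0, by simp, fun y hy => absurd (hA y hy) (by simp [OracleAlg.numQueries])⟩
    | succ q =>
      -- A branch inherits the query bound only for strings giving the answer that leads to it,
      -- which is why the claim is relative to `Y`.
      have hs : ∀ s : ℤˣ, ∃ c : (Fin q → Option (Fin n)) → ℝ, ∑ C, |c C| ≤ 2 ^ q ∧
          ∀ y ∈ {y | y ∈ Y ∧ y v = s}, sgn ((next s).run y) =
            ∑ C, c C * ∏ r, querySign y (C r) := by
        refine fun s => ih s q _ fun y hy => ?_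
        have := hA y hy.1
        rw [OracleAlg.numQueries, hy.2] at this
        omega
      choose c hc1 hc2 using hs
      -- Interpolate between the branches: `(1 + y_v) / 2` times the first plus `(1 - y_v) / 2`
      -- times the second.
      refine ⟨fun C => (C 0).elim ((c 1 (Fin.tail C) + c (-1) (Fin.tail C)) / 2)
        fun w => if w = v then (c 1 (Fin.tail C) - c (-1) (Fin.tail C)) / 2 else 0, ?_,
        fun y hy => ?_⟩
      · rw [sum_fin_succ_option]
        simp only [Fin.cons_zero, Fin.tail_cons, Option.elim]
        rw [sum_eq_single v (fun w _ hw => by simp [hw]) (by simp)]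
        simp only [if_true]
        rw [← sum_add_distrib]
        calc _ ≤ ∑ C, (|c 1 C| + |c (-1) C|) := by
              refine sum_le_sum fun C _ => ?_
              rw [abs_div, abs_div, abs_of_pos (by norm_num : (0 : ℝ) < 2)]
              have h1 := abs_add_le (c 1 C) (c (-1) C)
              have h2 := abs_sub (c 1 C) (c (-1) C)
              linarith
          _ ≤ 2 ^ (q + 1) := by
              rw [sum_add_distrib, pow_succ]
              linarith [hc1 1, hc1 (-1)]
      · rw [sum_fin_succ_option]
        simp only [Fin.cons_zero, Fin.tail_cons, Option.elim_none, Option.elim_some,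
          Fin.prod_univ_succ, Fin.cons_succ]
        rw [sum_eq_single v (fun w _ hw => by simp [hw]) (by simp)]
        simp only [if_true, querySign_none, querySign_some]
        rw [← sum_add_distrib, OracleAlg.run]
        have h := hc2 (y v) y ⟨hy, rfl⟩
        rw [h]
        refine sum_congr rfl fun C _ => ?_
        rcases Int.units_eq_one_or (y v) with h1 | h1 <;> rw [h1] <;>
          simp only [sgn_neg, sgn_one] <;> ring

lemma sgn_mul_sgn (a a' : ℤˣ) : sgn a * sgn a' = 2 * (if a = a' then 1 else 0) - 1 := by
  rcases Int.units_eq_one_or a with rfl | rfl <;> rcases Int.units_eq_one_or a' with rfl | rfl <;>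
    simp [sgn] <;> norm_num

/-- The bias of a randomized decoder is such a polynomial too. -/
lemma exists_fourier_coeff_pmf (D : PMF (OracleAlg n))
    (hD : ∀ A ∈ D.support, ∀ y : Fin n → ℤˣ, A.numQueries y ≤ q) :
    ∃ c : (Fin q → Option (Fin n)) → ℝ, ∑ C, |c C| ≤ 2 ^ q ∧
      ∀ (y : Fin n → ℤˣ) (a : ℤˣ), sgn a * ∑ C, c C * ∏ r, querySign y (C r) =
        2 * (D.map (OracleAlg.run y) a).toReal - 1 := by
  classical
  have hex : ∀ A : OracleAlg n, ∃ c : (Fin q → Option (Fin n)) → ℝ, ∑ C, |c C| ≤ 2 ^ q ∧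
      ∀ y : Fin n → ℤˣ, (D A).toReal * sgn (A.run y) =
        (D A).toReal * ∑ C, c C * ∏ r, querySign y (C r) := by
    intro A
    by_cases hA : A ∈ D.support
    · obtain ⟨c, h1, h2⟩ := exists_fourier_coeff q A Set.univ fun y _ => hD A hA y
      exact ⟨c, h1, fun y => by rw [h2 y trivial]⟩
    · have h0 : D A = 0 := by simpa [PMF.mem_support_iff] using hA
      exact ⟨0, by simp, fun y => by simp [h0]⟩
  choose c hc1 hc2 using hex
  have hsumD : HasSum (fun A => (D A).toReal) 1 := by
    have h := D.tsum_coe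
    have h1 : Summable fun A => (D A).toReal :=
      ENNReal.summable_toReal (by rw [h]; exact ENNReal.one_ne_top)
    have h2 : ∑' A, (D A).toReal = 1 := by
      rw [← ENNReal.tsum_toReal_eq fun A => D.apply_ne_top A, h, ENNReal.toReal_one]
    rw [← h2]
    exact h1.hasSum
  have hcle : ∀ A C, |c A C| ≤ 2 ^ q := fun A C =>
    (single_le_sum (f := fun C => |c A C|) (fun _ _ => abs_nonneg _) (mem_univ C)).trans (hc1 A)
  have hsummable : ∀ C, Summable fun A => (D A).toReal * c A C := fun C =>
    Summable.of_norm_bounded (hsumD.summable.mul_right (2 ^ q)) fun A => by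
      rw [Real.norm_eq_abs, abs_mul, abs_of_nonneg ENNReal.toReal_nonneg]
      exact mul_le_mul_of_nonneg_left (hcle A C) ENNReal.toReal_nonneg
  have habs : ∀ C, Summable fun A => |(D A).toReal * c A C| := fun C => (hsummable C).abs
  refine ⟨fun C => ∑' A, (D A).toReal * c A C, ?_, fun y a => ?_⟩
  · calc ∑ C, |∑' A, (D A).toReal * c A C| ≤ ∑ C, ∑' A, |(D A).toReal * c A C| := by
          refine sum_le_sum fun C _ => ?_
          have := norm_tsum_le_tsum_norm (f := fun A => (D A).toReal * c A C) (habs C)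
          simpa [Real.norm_eq_abs] using this
      _ = ∑' A, ∑ C, |(D A).toReal * c A C| := (Summable.tsum_finsetSum fun C _ => habs C).symm
      _ ≤ ∑' A, (D A).toReal * 2 ^ q := by
          refine Summable.tsum_le_tsum (fun A => ?_) (summable_sum fun C _ => habs C)
            (hsumD.summable.mul_right _)
          simp_rw [abs_mul, abs_of_nonneg (ENNReal.toReal_nonneg (a := D A))]
          rw [← mul_sum]
          exact mul_le_mul_of_nonneg_left (hc1 A) ENNReal.toReal_nonneg
      _ = 2 ^ q := by rw [(hsumD.mul_right _).tsum_eq, one_mul]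
  · have h1 : ∑ C, (∑' A, (D A).toReal * c A C) * ∏ r, querySign y (C r) =
        ∑' A, (D A).toReal * sgn (A.run y) := by
      simp_rw [← tsum_mul_right]
      rw [← Summable.tsum_finsetSum fun C _ => (hsummable C).mul_right _]
      refine tsum_congr fun A => ?_
      rw [hc2, mul_sum]
      exact sum_congr rfl fun C _ => by ring
    have h2 : (D.map (OracleAlg.run y) a).toReal =
        ∑' A, (D A).toReal * if a = A.run y then 1 else 0 := by
      rw [PMF.map_apply, ENNReal.tsum_toReal_eq]
      · refine tsum_congr fun A => ?_
        split_ifs <;> simp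
      · intro A
        split_ifs
        exacts [D.apply_ne_top A, ENNReal.zero_ne_top]
    have h3 : Summable fun A => (D A).toReal * if a = A.run y then (1 : ℝ) else 0 :=
      Summable.of_nonneg_of_le (fun A => mul_nonneg ENNReal.toReal_nonneg (by split_ifs <;> simp))
        (fun A => mul_le_of_le_one_right ENNReal.toReal_nonneg (by split_ifs <;> simp))
        hsumD.summable
    rw [h1, h2, ← tsum_mul_left, ← ((h3.hasSum.mul_left 2).sub hsumD).tsum_eq]
    refine tsum_congr fun A => ?_
    rw [mul_left_comm, sgn_mul_sgn]
    ring

/-- Redirect a query to the corresponding coordinate, or, if it is empty or lies in `B`, to a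
uniformly random dummy coordinate. -/
noncomputable def redirect (B : Finset (Fin n)) (o : Option (Fin n)) (v : Fin n ⊕ Fin n) : ℝ :=
  v.elim (fun w => if o = some w ∧ w ∉ B then 1 else 0)
    fun _ => if ∃ w, o = some w ∧ w ∉ B then 0 else 1 / n

lemma redirect_nonneg (B : Finset (Fin n)) (o : Option (Fin n)) (v : Fin n ⊕ Fin n) :
    0 ≤ redirect B o v := by
  rcases v with w | w <;> simp only [redirect, Sum.elim_inl, Sum.elim_inr] <;> split_ifs <;>
    positivity

/-- On average, a redirected query reads the string with its entries on `B` replaced by 1, so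
redirection simulates a corruption of the codeword. -/
lemma sum_redirect_mul (hn : 0 < n) (B : Finset (Fin n)) (o : Option (Fin n)) (y : Fin n → ℤˣ) :
    ∑ v, redirect B o v * Sum.elim (fun w => sgn (y w)) (fun _ => 1) v =
      querySign (fun w => if w ∈ B then 1 else y w) o := by
  have hn' : (n : ℝ) ≠ 0 := by exact_mod_cast hn.ne'
  rw [Fintype.sum_sum_type]
  simp only [redirect, Sum.elim_inl, Sum.elim_inr, mul_one, sum_const, card_univ, Fintype.card_fin,
    nsmul_eq_mul]
  by_cases h : ∃ w, o = some w ∧ w ∉ B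
  · rw [if_pos h, mul_zero, add_zero]
    obtain ⟨w, rfl, hw⟩ := h
    rw [sum_eq_single w]
    · simp [querySign, hw]
    · intro w' _ hw'
      rw [if_neg, zero_mul]
      rintro ⟨h1, -⟩
      exact hw' (Option.some_injective _ h1).symm
    · simp
  · rw [if_neg h, mul_one_div_cancel hn', sum_eq_zero]
    · rcases o with _ | w
      · simp [querySign]
      · have : w ∈ B := by
          by_contra hw; exact h ⟨w, rfl, hw⟩
        simp [querySign, this, sgn_one]
    · intro w _
      rw [if_neg fun hw => h ⟨w, hw⟩, zero_mul]

lemma sum_redirect (hn : 0 < n) (B : Finset (Fin n)) (o : Option (Fin n)) :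
    ∑ v, redirect B o v = 1 := by
  have h := sum_redirect_mul hn B o fun _ => 1
  have h1 : ∀ v : Fin n ⊕ Fin n, Sum.elim (fun _ : Fin n => sgn 1) (fun _ : Fin n => (1 : ℝ)) v = 1 := by
    rintro (w | w) <;> simp [sgn_one]
  simp only [h1, mul_one] at h
  rw [h]
  rcases o with _ | w <;> simp [querySign, sgn_one]

/-- The tuple weights obtained by redirecting all queries independently. -/
noncomputable def redirectWeights (c : (Fin q → Option (Fin n)) → ℝ) (B : Finset (Fin n))
    (C' : Fin q → Fin n ⊕ Fin n) : ℝ := ∑ C, c C / 2 ^ q * ∏ r, redirect B (C r) (C' r)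

lemma sum_redirectWeights_mul (c : (Fin q → Option (Fin n)) → ℝ) (B : Finset (Fin n))
    (g : Fin q → Fin n ⊕ Fin n → ℝ) :
    ∑ C', redirectWeights c B C' * ∏ r, g r (C' r) =
      ∑ C, c C / 2 ^ q * ∏ r, ∑ v, redirect B (C r) v * g r v := by
  unfold redirectWeights
  simp_rw [sum_mul, prod_univ_sum, Fintype.piFinset_univ, mul_sum]
  rw [sum_comm]
  refine sum_congr rfl fun C _ => sum_congr rfl fun C' _ => ?_
  rw [prod_mul_distrib, mul_assoc]

lemma abs_redirectWeights_le (c : (Fin q → Option (Fin n)) → ℝ) (B : Finset (Fin n))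
    (C' : Fin q → Fin n ⊕ Fin n) :
    |redirectWeights c B C'| ≤ redirectWeights (fun C => |c C|) B C' := by
  refine (abs_sum_le_sum_abs _ _).trans (sum_le_sum fun C _ => le_of_eq ?_)
  rw [abs_mul, abs_div, abs_of_pos (by positivity : (0 : ℝ) < 2 ^ q), abs_prod]
  congr 1
  exact prod_congr rfl fun r _ => abs_of_nonneg (redirect_nonneg B _ _)

lemma sum_abs_redirectWeights_le (hn : 0 < n) {c : (Fin q → Option (Fin n)) → ℝ}
    (hc : ∑ C, |c C| ≤ 2 ^ q) (B : Finset (Fin n)) : ∑ C', |redirectWeights c B C'| ≤ 1 := by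
  refine (sum_le_sum fun C' _ => abs_redirectWeights_le c B C').trans ?_
  have h := sum_redirectWeights_mul (fun C => |c C|) B fun _ _ => 1
  simp only [prod_const_one, mul_one, sum_redirect hn] at h
  rw [h, ← sum_div, div_le_one (by positivity)]
  exact hc

lemma sum_abs_redirectWeights_slot_le (hn : 0 < n) (c : (Fin q → Option (Fin n)) → ℝ)
    (B : Finset (Fin n)) (r : Fin q) (v : Fin n ⊕ Fin n) :
    ∑ C', (if C' r = v then |redirectWeights c B C'| else 0) ≤
      ∑ C, |c C| / 2 ^ q * redirect B (C r) v := by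
  have h := sum_redirectWeights_mul (fun C => |c C|) B
    fun r' v' => if r' = r then (if v' = v then 1 else 0) else 1
  have h1 : ∀ C' : Fin q → Fin n ⊕ Fin n,
      ∏ r', (if r' = r then (if C' r' = v then (1 : ℝ) else 0) else 1) =
        if C' r = v then 1 else 0 := by
    intro C'
    rw [prod_ite_eq' univ r, if_pos (mem_univ _)]
  have h2 : ∀ C : Fin q → Option (Fin n), ∏ r', ∑ v', redirect B (C r') v' *
      (if r' = r then (if v' = v then (1 : ℝ) else 0) else 1) = redirect B (C r) v := by
    intro C
    rw [prod_eq_single r]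
    · simp
    · intro r' _ hr'
      simp [hr', sum_redirect hn]
    · simp
  simp only [h1, h2] at h
  rw [← h]
  refine sum_le_sum fun C' _ => ?_
  split_ifs
  · rw [mul_one]; exact abs_redirectWeights_le c B C'
  · rw [mul_zero]

/-- Coordinates which are queried with probability more than `τ`. -/
noncomputable def heavyCoords (c : (Fin q → Option (Fin n)) → ℝ) (τ : ℝ) : Finset (Fin n) :=
  {v | τ < ∑ r, ∑ C, if C r = some v then |c C| / 2 ^ q else 0}

/-- Double counting: the normalised query weight, summed over all coordinates, is at most 1 per
slot. -/
lemma card_heavyCoords_le {c : (Fin q → Option (Fin n)) → ℝ} (hc : ∑ C, |c C| ≤ 2 ^ q) (τ : ℝ) :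
    #(heavyCoords c τ) * τ ≤ q := by
  calc #(heavyCoords c τ) * τ
      ≤ ∑ v ∈ heavyCoords c τ, ∑ r, ∑ C, (if C r = some v then |c C| / 2 ^ q else 0) := by
        rw [← nsmul_eq_mul]
        refine card_nsmul_le_sum _ _ _ fun v hv => ?_
        simp only [heavyCoords, mem_filter, mem_univ, true_and] at hv
        exact hv.le
    _ ≤ ∑ v, ∑ r, ∑ C, (if C r = some v then |c C| / 2 ^ q else 0) :=
        sum_le_sum_of_subset_of_nonneg (subset_univ _) fun v _ _ =>
          sum_nonneg fun r _ => sum_nonneg fun C _ => by split_ifs <;> positivity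
    _ = ∑ r : Fin q, ∑ C, ∑ v, (if C r = some v then |c C| / 2 ^ q else 0) := by
        rw [sum_comm]
        exact sum_congr rfl fun r _ => sum_comm
    _ ≤ ∑ _r : Fin q, (1 : ℝ) := by
        refine sum_le_sum fun r _ => ?_
        calc _ ≤ ∑ C, |c C| / 2 ^ q := by
              refine sum_le_sum fun C _ => ?_
              rcases hC : C r with _ | w
              · simp; positivity
              · simp
          _ ≤ 1 := by rw [← sum_div, div_le_one (by positivity)]; exact hc
    _ = q := by simp

/-- A locally decodable code yields, for each message coordinate, a smooth signed distribution of
query tuples (padded by dummy coordinates) whose products correlate with that coordinate. -/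
lemma exists_smooth_system {k : ℕ} {δ ε : ℝ} {E : (Fin k → ℤˣ) → (Fin n → ℤˣ)} (hn : 0 < n)
    (hδ : 0 < δ) (hδq : δ ≤ q) (hq : 0 < q) (hE : IsLocallyDecodable q δ ε E) :
    ∃ p : Fin k → (Fin q → Fin n ⊕ Fin n) → ℝ, (∀ i, ∑ C, |p i C| ≤ 1) ∧
      (∀ i r v, ∑ C, (if C r = v then |p i C| else 0) ≤ q / (δ * n)) ∧
      ∀ b i, 2 * ε / 2 ^ q ≤ sgn (b i) *
        ∑ C, p i C * ∏ r, Sum.elim (fun w => sgn (E b w)) (fun _ => 1) (C r) := by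
  obtain ⟨Dec, hDec, hcorrect⟩ := hE
  choose c hc1 hc2 using fun i => exists_fourier_coeff_pmf (Dec i) (hDec i)
  have hn' : (0 : ℝ) < n := by exact_mod_cast hn
  have hq' : (0 : ℝ) < q := by exact_mod_cast hq
  -- The threshold at which at most `δ * n` coordinates are heavy.
  set τ : ℝ := q / (δ * n) with hτ
  have hτ0 : 0 < τ := by positivity
  refine ⟨fun i => redirectWeights (c i) (heavyCoords (c i) τ),
    fun i => sum_abs_redirectWeights_le hn (hc1 i) _, fun i r v => ?_, fun b i => ?_⟩
  · refine (sum_abs_redirectWeights_slot_le hn (c i) _ r v).trans ?_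
    rcases v with w | w
    · by_cases hw : w ∈ heavyCoords (c i) τ
      · refine le_trans (le_of_eq (sum_eq_zero fun C _ => ?_)) hτ0.le
        simp [redirect, hw]
      · have hw' : ∑ r, ∑ C, (if C r = some w then |c i C| / 2 ^ q else 0) ≤ τ := by
          simpa [heavyCoords] using hw
        refine le_trans ?_ hw'
        refine le_trans (le_of_eq (sum_congr rfl fun C _ => ?_))
          (single_le_sum (f := fun r => ∑ C, if C r = some w then |c i C| / 2 ^ q else 0)
            (fun r _ => sum_nonneg fun C _ => by split_ifs <;> positivity) (mem_univ r))
        simp [redirect, hw]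
    · calc _ ≤ ∑ C, |c i C| / 2 ^ q * (1 / n) := by
            refine sum_le_sum fun C _ => mul_le_mul_of_nonneg_left ?_ (by positivity)
            simp only [redirect, Sum.elim_inr]
            split_ifs
            · positivity
            · exact le_rfl
        _ ≤ 1 * (1 / n) := by
            rw [← sum_mul, ← sum_div]
            refine mul_le_mul_of_nonneg_right ?_ (by positivity)
            rw [div_le_one (by positivity)]
            exact hc1 i
        _ ≤ τ := by
            rw [one_mul, hτ, div_le_div_iff₀ hn' (by positivity)]
            nlinarith
  · rw [sum_redirectWeights_mul (c i) _ fun _ => Sum.elim (fun w => sgn (E b w)) (fun _ => 1)]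
    simp_rw [sum_redirect_mul hn]
    set B := heavyCoords (c i) τ with hB
    set y : Fin n → ℤˣ := fun w => if w ∈ B then 1 else E b w with hy
    have hdist : (hammingDist y (E b) : ℝ) ≤ δ * n := by
      have h1 : hammingDist y (E b) ≤ #B := by
        refine card_le_card fun w hw => ?_
        by_contra hwB
        simp [hy, hwB] at hw
      have h2 := card_heavyCoords_le (hc1 i) τ
      have h3 : (#B : ℝ) ≤ δ * n := by
        rw [hτ, ← mul_div_assoc, div_le_iff₀ (by positivity)] at h2
        have : (#B : ℝ) * q ≤ (δ * n) * q := by linarith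
        exact le_of_mul_le_mul_right this hq'
      exact (Nat.cast_le.2 h1).trans h3
    have h4 := hcorrect i b y hdist
    have h5 := hc2 i y (b i)
    have h6 : ∑ C, c i C / 2 ^ q * ∏ r, querySign y (C r) =
        (∑ C, c i C * ∏ r, querySign y (C r)) / 2 ^ q := by
      rw [sum_div]
      exact sum_congr rfl fun C _ => by ring
    rw [h6, ← mul_div_assoc, h5]
    gcongr
    linarith

/-- If `δ ≥ 1`, the all-ones string is within tolerance of the codewords of both `1` and `-1`, so
the decoder would have to output each of two opposite signs with probability above 1/2. -/
lemma epsilon_le_and_delta_lt {k : ℕ} {δ ε : ℝ} {E : (Fin k → ℤˣ) → (Fin n → ℤˣ)} (hk : 0 < k)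
    (hδ : 0 < δ) (hε : 0 < ε) (hE : IsLocallyDecodable q δ ε E) : ε ≤ 1 / 2 ∧ δ < 1 := by
  obtain ⟨Dec, hDec, hcorrect⟩ := hE
  set i : Fin k := ⟨0, hk⟩
  constructor
  · have h := hcorrect i 1 (E 1) (by rw [hammingDist_self]; push_cast; positivity)
    have h1 : ((Dec i).map (OracleAlg.run (E 1)) ((1 : Fin k → ℤˣ) i)).toReal ≤ 1 := by
      have := ENNReal.toReal_mono ENNReal.one_ne_top
        (((Dec i).map (OracleAlg.run (E 1))).coe_le_one ((1 : Fin k → ℤˣ) i))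
      simpa using this
    linarith
  · by_contra hδ1
    obtain ⟨c, -, hc⟩ := exists_fourier_coeff_pmf (Dec i) (hDec i)
    have hclose : ∀ b : Fin k → ℤˣ, (hammingDist (1 : Fin n → ℤˣ) (E b) : ℝ) ≤ δ * n := by
      intro b
      have h1 : (hammingDist (1 : Fin n → ℤˣ) (E b) : ℝ) ≤ n := by
        exact_mod_cast (hammingDist_le_card_fintype).trans (by simp)
      have h2 : (1 : ℝ) * n ≤ δ * n := by
        gcongr
        exact not_lt.1 hδ1
      linarith
    have h1 := hcorrect i 1 1 (hclose 1)
    have h2 := hcorrect i (-1) 1 (hclose (-1))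
    have h3 := hc 1 1
    have h4 := hc 1 (-1)
    rw [Pi.one_apply] at h1
    rw [Pi.neg_apply, Pi.one_apply] at h2
    rw [sgn_one] at h3
    rw [sgn_neg, sgn_one] at h4
    linarith

end Decoder

/-! ### Elementary estimates -/

section Numerics

lemma sq_mul_le_of_mul_le_sqrt {a k B S : ℝ} (ha : 0 ≤ a) (hk : 0 < k) (hS : 0 ≤ S)
    (h : a * k ≤ B * Real.sqrt (32 * k * S)) : a ^ 2 * k ≤ 32 * B ^ 2 * S := by
  have h1 := pow_le_pow_left₀ (by positivity) h 2
  rw [mul_pow, mul_pow, Real.sq_sqrt (by positivity)] at h1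
  refine le_of_mul_le_mul_right ?_ hk
  linarith

lemma half_lt_log {n : ℕ} (hn : 2 ≤ n) : 69 / 100 < Real.log n := by
  have h1 := Real.log_two_gt_d9
  have h2 : Real.log 2 ≤ Real.log n := Real.log_le_log (by norm_num) (by exact_mod_cast hn)
  linarith

lemma log_two_mul_le {n : ℕ} (hn : 2 ≤ n) : Real.log ((2 * n : ℕ) : ℝ) ≤ 2 * Real.log n := by
  have hn' : (n : ℝ) ≠ 0 := by positivity
  have h2 : Real.log 2 ≤ Real.log n := Real.log_le_log (by norm_num) (by exact_mod_cast hn)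
  push_cast
  rw [Real.log_mul (by norm_num) hn']
  linarith

/-- The argument yields a single logarithm at worst; this relaxes it to the fourth power. -/
lemma one_le_and_le_mul_pow_four {L : ℝ} (hL : 69 / 100 < L) : 1 ≤ 5 * L ^ 4 ∧ L ≤ 4 * L ^ 4 := by
  have h3 : (69 / 100 : ℝ) ^ 3 ≤ L ^ 3 := pow_le_pow_left₀ (by norm_num) hL.le 3
  have h4 : (69 / 100 : ℝ) ^ 4 ≤ L ^ 4 := pow_le_pow_left₀ (by norm_num) hL.le 4
  constructor
  · norm_num at h4; linarith
  · norm_num at h3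
    nlinarith

end Numerics

/-! ### Choice of parameters and the final bound -/

section LowerBound

variable {k n q : ℕ} {δ ε : ℝ} {E : (Fin k → ℤˣ) → (Fin n → ℤˣ)}

/-- The codeword as a sign vector, padded by ones on the dummy coordinates. -/
def paddedCodeword (E : (Fin k → ℤˣ) → (Fin n → ℤˣ)) (b : Fin k → ℤˣ) : Fin n ⊕ Fin n → ℝ :=
  Sum.elim (fun w => sgn (E b w)) fun _ => 1

lemma paddedCodeword_mul_self (b : Fin k → ℤˣ) (v : Fin n ⊕ Fin n) :
    paddedCodeword E b v * paddedCodeword E b v = 1 := by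
  rcases v with w | w <;> simp [paddedCodeword, sgn_mul_self]

lemma signal_le {p : Fin k → (Fin q → Fin n ⊕ Fin n) → ℝ} {η : ℝ}
    (h : ∀ b i, η ≤ sgn (b i) * ∑ C, p i C * ∏ r, paddedCodeword E b (C r)) :
    2 ^ Fintype.card (Fin k) * (η * Fintype.card (Fin k)) ≤
      ∑ b : Fin k → ℤˣ, ∑ i, sgn (b i) * ∑ C, p i C * ∏ r, paddedCodeword E b (C r) := by
  rw [← card_signs, ← nsmul_eq_mul, ← card_univ]
  refine card_nsmul_le_sum _ _ _ fun b _ => ?_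
  rw [mul_comm, ← nsmul_eq_mul, ← card_univ]
  exact card_nsmul_le_sum _ _ _ fun i _ => h b i

variable (hq : 3 ≤ q) (hn : 2 ≤ n) (hk : 0 < k) (hδ : 0 < δ) (hδ1 : δ ≤ 1) (hε : 0 < ε)
  (hε1 : ε ≤ 1 / 2) {p : Fin k → (Fin q → Fin n ⊕ Fin n) → ℝ} (hp1 : ∀ i, ∑ C, |p i C| ≤ 1)
  (hp : ∀ i r v, ∑ C, (if C r = v then |p i C| else 0) ≤ q / (δ * n))
  (hcorr : ∀ b i, 2 * ε / 2 ^ q ≤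
    sgn (b i) * ∑ C, p i C * ∏ r, paddedCodeword E b (C r))

include hq hn hk hε hp1 hcorr in
-- The bound without smoothness, with a dummy coordinate as `v₀`; it serves when `ε ^ 3 * δ * n` is
-- too small for a density below 1.
lemma card_message_le : k * ε ^ 2 ≤ 2560 * 16 ^ q * q * n * Real.log n := by
  have hn' : (2 : ℝ) ≤ n := by exact_mod_cast hn
  have hq' : (3 : ℝ) ≤ q := by exact_mod_cast hq
  have hk' : (0 : ℝ) < k := by exact_mod_cast hk
  have hL := half_lt_log hn
  have h1 := signal_le hcorr
  have h2 := h1.trans (sum_signed_tuples_le hp1 (paddedCodeword E) paddedCodeword_mul_self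
    (Sum.inr ⟨0, by omega⟩) fun _ => rfl)
  have h3 := le_of_mul_le_mul_left h2 (by positivity)
  have hcV : Fintype.card (Fin n ⊕ Fin n) = 2 * n := by simp [two_mul]
  rw [hcV, Fintype.card_fin] at h3
  have hlog0 : 0 ≤ Real.log ((2 * n : ℕ) : ℝ) := Real.log_natCast_nonneg _
  have h4 := sq_mul_le_of_mul_le_sqrt (by positivity) hk' (by positivity) h3
  have h5 : q * ((2 * n : ℕ) : ℝ) * Real.log ((2 * n : ℕ) : ℝ) + 1 ≤ 5 * (q * n * Real.log n) := by
    have h6 : q * ((2 * n : ℕ) : ℝ) * Real.log ((2 * n : ℕ) : ℝ) ≤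
        q * ((2 * n : ℕ) : ℝ) * (2 * Real.log n) :=
      mul_le_mul_of_nonneg_left (log_two_mul_le hn) (by positivity)
    have h7 : (3 : ℝ) * 2 * (69 / 100) ≤ q * n * Real.log n := by gcongr
    push_cast at h6 ⊢
    linarith
  have h8 : (2 * ε / 2 ^ q) ^ 2 * k ≤ 32 * (8 * 2 ^ q) ^ 2 * (5 * (q * n * Real.log n)) :=
    h4.trans (mul_le_mul_of_nonneg_left h5 (by positivity))
  rw [div_pow, div_mul_eq_mul_div, div_le_iff₀ (by positivity)] at h8
  have h9 : (16 : ℝ) ^ q = 2 ^ q * 2 ^ q * 2 ^ q * 2 ^ q := by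
    rw [← mul_pow, ← mul_pow, ← mul_pow]; norm_num
  rw [h9]
  linarith

include hq hn hk hδ hε hε1 hp1 hp hcorr in
lemma card_message_le_of_smooth {m : ℕ} {κ₀ : ℝ} (hκ₀ : 0 < κ₀)
    (hκ₀q : κ₀ ^ q = 2 * 32 ^ q * q / (ε ^ 3 * δ * n)) (hm : κ₀ ^ 2 * (2 * n) ≤ m)
    (hm' : m ≤ 2 * n) (hmk : m ≤ k) :
    k * ε ^ 4 ≤ 393216 * 1024 ^ q * q * m * Real.log n := by
  have hn' : (2 : ℝ) ≤ n := by exact_mod_cast hn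
  have hq' : (3 : ℝ) ≤ q := by exact_mod_cast hq
  have hk' : (0 : ℝ) < k := by exact_mod_cast hk
  have hL := half_lt_log hn
  have hcV : Fintype.card (Fin n ⊕ Fin n) = 2 * n := by simp [two_mul]
  have hm0 : (1 : ℝ) ≤ m := by
    have : (0 : ℝ) < m := lt_of_lt_of_le (by positivity) hm
    exact_mod_cast this
  have hne : Nonempty (Fin n ⊕ Fin n) := ⟨Sum.inr ⟨0, by omega⟩⟩
  -- The density must be exactly `m / (2 * n)` with `m` an integer, so `κ₀` is rounded up to this
  -- `κ`.
  set κ : ℝ := Real.sqrt (m / (2 * n : ℕ)) with hκ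
  have hκ2 : κ ^ 2 = m / (2 * n : ℕ) := Real.sq_sqrt (by positivity)
  have hκle : κ₀ ≤ κ := by
    refine Real.le_sqrt_of_sq_le ?_
    rw [le_div_iff₀ (by positivity)]
    push_cast
    exact hm
  have hκpos : 0 < κ := hκ₀.trans_le hκle
  have hκ1 : κ ≤ 1 := by
    refine Real.sqrt_le_iff.2 ⟨zero_le_one, ?_⟩
    rw [one_pow, div_le_one (by positivity)]
    exact_mod_cast hm'
  have h2q : (1 : ℝ) ≤ 2 ^ q := one_le_pow₀ (by norm_num)
  have h32 : (32 : ℝ) ^ q = 4 ^ q * (2 ^ q * 2 ^ q * 2 ^ q) := by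
    rw [← mul_pow, ← mul_pow, ← mul_pow]; norm_num
  -- The value of `κ₀ ^ q` is chosen to make this an equality at `κ₀`.
  have hτκ : 16 * 4 ^ q * (q / (δ * n)) ≤ (2 * ε / 2 ^ q) ^ 3 * κ ^ q := by
    calc 16 * 4 ^ q * (q / (δ * n)) = (2 * ε / 2 ^ q) ^ 3 * κ₀ ^ q := by
          rw [hκ₀q, h32]; field_simp; ring
      _ ≤ _ := by gcongr
  have h1 := smooth_system_bound (p := p) (by omega) hκpos hκ1 (by rw [hκ2, hcV]) hp1 hp
    (by positivity) (paddedCodeword E) paddedCodeword_mul_self (η := 2 * ε / 2 ^ q) (by positivity)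
    (by rw [div_le_one (by positivity)]; linarith) (by simpa using hk) (by simpa using hmk) hτκ
    (signal_le hcorr)
  rw [hcV, Fintype.card_fin] at h1
  have hlog0 : 0 ≤ Real.log ((2 * n : ℕ) : ℝ) := Real.log_natCast_nonneg _
  have h3 := sq_mul_le_of_mul_le_sqrt (a := (2 * ε / 2 ^ q / 2 ^ (q + 1)) ^ 2 / 8) (by positivity)
    hk' (by positivity) (le_trans (le_of_eq (by ring)) h1)
  have h5 : q * m * Real.log ((2 * n : ℕ) : ℝ) + 1 ≤ 3 * (q * m * Real.log n) := by
    have h6 : q * m * Real.log ((2 * n : ℕ) : ℝ) ≤ q * m * (2 * Real.log n) :=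
      mul_le_mul_of_nonneg_left (log_two_mul_le hn) (by positivity)
    have h7 : (3 : ℝ) * 1 * (69 / 100) ≤ q * m * Real.log n := by gcongr
    linarith
  have h8 := h3.trans (mul_le_mul_of_nonneg_left h5 (by positivity))
  set t : ℝ := 2 ^ q with ht
  have ht0 : 0 < t := by positivity
  have h9 : (1024 : ℝ) ^ q = t ^ 10 := by
    rw [ht, ← pow_mul, mul_comm, pow_mul]; norm_num
  have h10 : ((2 * ε / t / 2 ^ (q + 1)) ^ 2 / 8) ^ 2 * k = k * ε ^ 4 / (64 * t ^ 8) := by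
    rw [pow_succ (2 : ℝ) q, ← ht]; field_simp; ring
  rw [h10, div_le_iff₀ (by positivity)] at h8
  rw [h9]
  linarith

include hq hn hk hδ hδ1 hε hε1 hp1 hp hcorr in
-- Here `w` plays the role of `n ^ (1 / q)` and `u` that of `n ^ (1 - 2 / q)`. Either `n` is so
-- small that the bound without smoothness suffices, or `m` is taken about `2 * κ₀ ^ 2 * n`, of
-- order `u / (ε * δ) ^ 2`.
lemma card_message_le_final {u w : ℝ} (hw : 0 < w) (hwq : w ^ q = n) (hu : u * w ^ 2 = n) :
    (k : ℝ) ≤ u * (2 ^ (30 * q) * Real.log n ^ 4 / (ε ^ 6 * δ ^ 2)) := by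
  have hn' : (2 : ℝ) ≤ n := by exact_mod_cast hn
  have hn0 : (0 : ℝ) < n := by linarith
  have hq' : (3 : ℝ) ≤ q := by exact_mod_cast hq
  have hk' : (0 : ℝ) < k := by exact_mod_cast hk
  have hL := half_lt_log hn
  set L := Real.log n with hLdef
  obtain ⟨hL1, hL4⟩ := one_le_and_le_mul_pow_four hL
  have hu0 : 0 < u := by
    have : 0 < u * w ^ 2 := by rw [hu]; exact hn0
    exact pos_of_mul_pos_left this (by positivity)
  have hqt : (q : ℝ) ≤ 2 ^ q := by exact_mod_cast Nat.lt_two_pow_self.le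
  set t : ℝ := 2 ^ q with ht
  have ht8 : 8 ≤ t := by
    calc (8 : ℝ) = 2 ^ 3 := by norm_num
      _ ≤ t := pow_le_pow_right₀ (by norm_num) hq
  have h30 : (2 : ℝ) ^ (30 * q) = t ^ 30 := by rw [ht, ← pow_mul, mul_comm]
  have hp16 : (16 : ℝ) ^ q = t ^ 4 := by rw [ht, ← pow_mul, mul_comm, pow_mul]; norm_num
  have hp32 : (32 : ℝ) ^ q = t ^ 5 := by rw [ht, ← pow_mul, mul_comm, pow_mul]; norm_num
  have hp1024 : (1024 : ℝ) ^ q = t ^ 10 := by rw [ht, ← pow_mul, mul_comm, pow_mul]; norm_num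
  have hp128 : (128 : ℝ) ^ q = t ^ 7 := by rw [ht, ← pow_mul, mul_comm, pow_mul]; norm_num
  have ht0 : 0 < t := by linarith
  have hεδ : 0 < ε ^ 6 * δ ^ 2 := by positivity
  rw [h30, ← mul_div_assoc, le_div_iff₀ hεδ]
  have hw1 : 1 ≤ w := by
    by_contra h
    have : w ^ q ≤ 1 := pow_le_one₀ hw.le (not_le.1 h).le
    linarith
  by_cases hX : ε ^ 3 * δ * n < 2 * 32 ^ q * q
  · have h1 := card_message_le hq hn hk hε hp1 hcorr
    have hwn : w ^ 2 ≤ n := by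
      rw [← hwq]; exact pow_le_pow_right₀ hw1 (by omega)
    have h2 : (n : ℝ) ≤ u * n := by
      calc (n : ℝ) = u * w ^ 2 := hu.symm
        _ ≤ u * n := by gcongr
    rw [hp16] at h1
    rw [hp32] at hX
    calc k * (ε ^ 6 * δ ^ 2) = (k * ε ^ 2) * (ε ^ 3 * δ) * (ε * δ) := by ring
      _ ≤ (2560 * t ^ 4 * q * n * L) * (ε ^ 3 * δ) * (1 * 1) := by
          gcongr; linarith
      _ ≤ (2560 * t ^ 4 * q * (u * n) * L) * (ε ^ 3 * δ) * (1 * 1) := by gcongr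
      _ = 2560 * t ^ 4 * q * u * L * (ε ^ 3 * δ * n) := by ring
      _ ≤ 2560 * t ^ 4 * q * u * L * (2 * t ^ 5 * q) := by gcongr
      _ ≤ 2560 * t ^ 4 * t * u * (4 * L ^ 4) * (2 * t ^ 5 * t) := by gcongr
      _ = u * (20480 * t ^ 11 * L ^ 4) := by ring
      _ ≤ u * (t ^ 19 * t ^ 11 * L ^ 4) := by
          gcongr
          calc (20480 : ℝ) ≤ 8 ^ 19 := by norm_num
            _ ≤ t ^ 19 := by gcongr
      _ = _ := by ring
  · rw [not_lt] at hX
    set X : ℝ := 2 * 32 ^ q * q / (ε ^ 3 * δ * n) with hXdef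
    have hX0 : 0 < X := by positivity
    have hX1 : X ≤ 1 := by rw [hXdef, div_le_one (by positivity)]; exact hX
    set κ₀ : ℝ := X ^ ((q : ℝ)⁻¹) with hκ₀
    have hκpos : 0 < κ₀ := Real.rpow_pos_of_pos hX0 _
    have hκ1 : κ₀ ≤ 1 := Real.rpow_le_one hX0.le hX1 (by positivity)
    have hκq : κ₀ ^ q = X := Real.rpow_inv_natCast_pow hX0.le (by omega)
    have hκn : 1 ≤ κ₀ ^ 2 * n := by
      have h1 : X ≤ κ₀ ^ 2 := by
        rw [← hκq]; exact pow_le_pow_of_le_one hκpos.le hκ1 (by omega)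
      have h2 : 1 ≤ X * n := by
        rw [hXdef, div_mul_eq_mul_div, le_div_iff₀ (by positivity), one_mul]
        have h3 : ε ^ 3 * δ ≤ 1 * 1 := by
          gcongr; exact pow_le_one₀ hε.le (by linarith)
        have h4 : (1 : ℝ) ≤ 32 ^ q := one_le_pow₀ (by norm_num)
        have h5 : (1 : ℝ) ≤ 2 * 32 ^ q * q := by nlinarith
        exact mul_le_mul_of_nonneg_right (by linarith) hn0.le
      calc 1 ≤ X * n := h2
        _ ≤ _ := by gcongr
    -- Compare `q`-th powers; `q ≥ 3` enters through `(ε * δ) ^ q ≤ ε ^ 3 * δ`.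
    have hκw : κ₀ * w ≤ 128 / (ε * δ) := by
      refine le_of_pow_le_pow_left₀ (n := q) (by omega) (by positivity) ?_
      rw [mul_pow, hκq, hwq, hXdef, div_pow, div_mul_eq_mul_div,
        mul_div_mul_right _ _ hn0.ne', hp32, hp128]
      have h1 : (ε * δ) ^ q ≤ ε ^ 3 * δ := by
        calc (ε * δ) ^ q ≤ (ε * δ) ^ 3 :=
              pow_le_pow_of_le_one (by positivity) (mul_le_one₀ (by linarith) hδ.le hδ1) hq
          _ = ε ^ 3 * δ * (δ * δ) := by ring
          _ ≤ ε ^ 3 * δ * 1 := by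
              gcongr; exact mul_le_one₀ hδ1 hδ.le hδ1
          _ = _ := mul_one _
      have h2 : 2 * t ^ 5 * q ≤ t ^ 7 := by
        calc 2 * t ^ 5 * q ≤ t * t ^ 5 * t := by gcongr; linarith
          _ = t ^ 7 := by ring
      gcongr
    have hκu : κ₀ ^ 2 * n * (ε * δ) ^ 2 ≤ 16384 * u := by
      have h1 : κ₀ * w * (ε * δ) ≤ 128 := by
        rwa [le_div_iff₀ (by positivity)] at hκw
      calc κ₀ ^ 2 * n * (ε * δ) ^ 2 = u * (κ₀ * w * (ε * δ)) ^ 2 := by rw [← hu]; ring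
        _ ≤ u * 128 ^ 2 := by gcongr
        _ = _ := by ring
    set m : ℕ := ⌈κ₀ ^ 2 * (2 * n)⌉₊ with hm
    have hm1 : κ₀ ^ 2 * (2 * n) ≤ m := Nat.le_ceil _
    have hm2 : (m : ℝ) ≤ 4 * (κ₀ ^ 2 * n) := by
      have := Nat.ceil_lt_add_one (a := κ₀ ^ 2 * (2 * n)) (by positivity)
      rw [← hm] at this
      linarith
    have hm3 : m ≤ 2 * n := by
      rw [hm]
      refine Nat.ceil_le.2 ?_
      push_cast
      refine mul_le_of_le_one_left (by positivity) (pow_le_one₀ hκpos.le hκ1)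
    have hmu : m * (ε * δ) ^ 2 ≤ 65536 * u := by
      calc m * (ε * δ) ^ 2 ≤ 4 * (κ₀ ^ 2 * n) * (ε * δ) ^ 2 := by gcongr
        _ ≤ _ := by linarith
    rcases le_total m k with hmk | hkm
    · have h1 := card_message_le_of_smooth hq hn hk hδ hε hε1 hp1 hp hcorr hκpos hκq
        hm1 hm3 hmk
      rw [hp1024, ← hLdef] at h1
      calc k * (ε ^ 6 * δ ^ 2) = (k * ε ^ 4) * (ε * δ) ^ 2 := by ring
        _ ≤ (393216 * t ^ 10 * q * m * L) * (ε * δ) ^ 2 := by gcongr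
        _ = 393216 * t ^ 10 * q * L * (m * (ε * δ) ^ 2) := by ring
        _ ≤ 393216 * t ^ 10 * t * (4 * L ^ 4) * (65536 * u) := by gcongr
        _ = u * (103079215104 * t ^ 11 * L ^ 4) := by ring
        _ ≤ u * (t ^ 19 * t ^ 11 * L ^ 4) := by
            gcongr
            calc (103079215104 : ℝ) ≤ 8 ^ 19 := by norm_num
              _ ≤ t ^ 19 := by gcongr
        _ = _ := by ring
    -- If `k ≤ m`, the bound on `m` already suffices.
    · have hkm' : (k : ℝ) ≤ m := by exact_mod_cast hkm
      calc k * (ε ^ 6 * δ ^ 2) = ε ^ 4 * (k * (ε * δ) ^ 2) := by ring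
        _ ≤ 1 * (m * (ε * δ) ^ 2) := by
            gcongr; exact pow_le_one₀ hε.le (by linarith)
        _ ≤ 65536 * u * 1 := by linarith
        _ ≤ 65536 * u * (5 * L ^ 4) := by gcongr
        _ = u * (327680 * L ^ 4) := by ring
        _ ≤ u * (t ^ 30 * L ^ 4) := by
            gcongr
            calc (327680 : ℝ) ≤ 8 ^ 30 := by norm_num
              _ ≤ t ^ 30 := by gcongr
        _ = _ := by ring

end LowerBound

theorem theorem4p1 :
    ∃ C : ℝ, 0 < C ∧
      ∀ (q k n : ℕ) (δ ε : ℝ) (E : (Fin k → ℤˣ) → (Fin n → ℤˣ)),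
        3 ≤ q → 2 ≤ n → 0 < δ → 0 < ε →
        IsLocallyDecodable q δ ε E →
          (k : ℝ) ≤ (n : ℝ) ^ (1 - 2 / (q : ℝ)) *
            ((2 : ℝ) ^ (C * (q : ℝ)) * Real.log (n : ℝ) ^ 4 / (ε ^ 6 * δ ^ 2)) := by
  -- The losses amount to `(2 ^ q) ^ 11` times a numerical constant; the remaining `(2 ^ q) ^ 19`
  -- absorbs the constant because `2 ^ q ≥ 8`.
  refine ⟨30, by norm_num, fun q k n δ ε E hq hn hδ hε hE => ?_⟩
  have hn0 : (0 : ℝ) < n := by positivity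
  rcases Nat.eq_zero_or_pos k with rfl | hk
  · have hL := half_lt_log hn
    push_cast
    positivity
  obtain ⟨hε1, hδ1⟩ := epsilon_le_and_delta_lt hk hδ hε hE
  have hq' : (3 : ℝ) ≤ q := by exact_mod_cast hq
  obtain ⟨p, hp1, hp, hcorr⟩ := exists_smooth_system (by omega) hδ (by linarith) (by omega) hE
  have hw : (0 : ℝ) < (n : ℝ) ^ ((q : ℝ)⁻¹) := Real.rpow_pos_of_pos hn0 _
  have hu : (n : ℝ) ^ (1 - 2 / (q : ℝ)) * ((n : ℝ) ^ ((q : ℝ)⁻¹)) ^ 2 = n := by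
    rw [← Real.rpow_natCast, ← Real.rpow_mul hn0.le, ← Real.rpow_add hn0]
    convert Real.rpow_one (n : ℝ) using 2
    push_cast
    ring
  have h := card_message_le_final hq hn hk hδ hδ1.le hε hε1 hp1 hp hcorr hw
    (Real.rpow_inv_natCast_pow hn0.le (by omega)) hu
  have h30 : (2 : ℝ) ^ ((30 : ℝ) * (q : ℝ)) = 2 ^ (30 * q) := by
    rw [← Real.rpow_natCast]
    push_cast
    rfl
  rwa [h30]
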